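/- Let $\Gamma$ be a finite graph (loops and multiple edges allowed) with a base vertex $v$ and a linear ordering of its edges. A state is a spanning subgraph of $\Gamma$, that is, a subset $s \subseteq E(\Gamma)$ together with all vertices. A reduced enhanced state is a state whose connected components are coloured by the two colours $x$ and $1$, the component of $v$ being coloured $x$. Its dimension is the number of edges of the state, its degree is the number of components coloured $x$, minus $1$. Let $\widetilde C^{i,j}(\Gamma)$ be the real vector space with basis the reduced enhanced states of dimension $i$ and degree $j$. The differential $d : \widetilde C^{i,j}(\Gamma) \to \widetilde C^{i+1,j}(\Gamma)$ sends a reduced enhanced state $S$ to the sum, over all edges $e$ of $\Gamma$ not in $S$, of $(-1)^{k(e)}\, S \cup e$, where $k(e)$ is the number of edges of $S$ that are smaller than $e$. Here $S \cup e$ keeps the colours of $S$ if $e$ does not join two different components; if it does, the new component gets the product of the two colours under the rule $1\cdot 1 = 1$, $1 \cdot x = x \cdot 1 = x$, $x \cdot x = 0$ (the term is $0$ in the last case). The reduced chromatic cohomology groups are $$\widetilde H^{i,j}(\Gamma) = \frac{\operatorname{Ker}(d : \widetilde C^{i,j}(\Gamma) \to \widetilde C^{i+1,j}(\Gamma))}{\operatorname{Im}(d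 : \widetilde C^{i-1,j}(\Gamma) \to \widetilde C^{i,j}(\Gamma))}.$$ The cycle matroid of $\Gamma$ is the matroid on $E(\Gamma)$ whose independent sets are the edge sets of forests. **Proposition.** The reduced chromatic cohomology is an invariant of the matroid type of a connected graph: if $\Gamma$ and $\Gamma'$ are finite connected graphs whose cycle matroids are isomorphic, then, for every choice of base vertices and of edge orderings of $\Gamma$ and $\Gamma'$, $$\widetilde H^{i,j}(\Gamma) \cong \widetilde H^{i,j}(\Gamma') \quad\text{as real vector spaces, for all } i, j.$$ -/

import Mathlib

set_option maxSynthPendingDepth 3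

namespace Graph

variable {α β : Type*}

/-! ### Spanning subgraphs and their connected components -/

/-- The vertices of `G`, two of them being identified when they lie in the same connected component
of the spanning subgraph of `G` with edge set `S` (all vertices of `G`, and the edges in `S`). -/
def componentSetoid (G : Graph α β) (S : Set β) : Setoid G.vertexSet :=
  Relation.EqvGen.setoid fun x y => ∃ e ∈ S, G.IsLink e x y

/-- The connected components of the spanning subgraph of `G` with edge set `S`. -/
def Component (G : Graph α β) (S : Set β) : Type _ := Quotient (G.componentSetoid S)

/-- The component of the spanning subgraph with edge set `S` that contains the vertex `v`. -/
def component (G : Graph α β) (S : Set β) (v : G.vertexSet) : G.Component S :=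
  Quotient.mk (G.componentSetoid S) v

/-- A graph is connected if it has a vertex and any two of its vertices lie in the same
component. -/
def IsConnected (G : Graph α β) : Prop :=
  G.vertexSet.Nonempty ∧
    ∀ v w : G.vertexSet, G.component G.edgeSet v = G.component G.edgeSet w

theorem componentSetoid_mono (G : Graph α β) {S T : Set β} (h : S ⊆ T) :
    G.componentSetoid S ≤ G.componentSetoid T := by
  intro x y hxy
  refine Setoid.eqvGen_le (s := G.componentSetoid T) ?_ hxy
  rintro a b ⟨e, he, hl⟩
  exact Relation.EqvGen.rel _ _ ⟨e, h he, hl⟩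

/-- For `S ⊆ T`, the map that sends a component of the spanning subgraph with edge set `S` to the
component of the spanning subgraph with edge set `T` that contains it. -/
def componentMap (G : Graph α β) {S T : Set β} (h : S ⊆ T) : G.Component S → G.Component T :=
  Quotient.map' id fun _ _ hxy => G.componentSetoid_mono h hxy

/-! ### The cycle matroid -/

/-- The edge `e` joins two vertices that lie in the same component of the spanning subgraph with
edge set `S`. -/
def Spans (G : Graph α β) (S : Set β) (e : β) : Prop :=
  ∃ x y : G.vertexSet, G.IsLink e x y ∧ G.component S x = G.component S y

/-- `I` is the edge set of a forest of `G`: no edge `e` of `I` lies on a cycle with edges in `I`,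
that is, the ends of `e` are not connected through the other edges of `I`. -/
def IsForest (G : Graph α β) (I : Set β) : Prop :=
  I ⊆ G.edgeSet ∧ ∀ e ∈ I, ¬ G.Spans (I \ {e}) e

theorem component_eq_iff (G : Graph α β) {S : Set β} {x y : G.vertexSet} :
    G.component S x = G.component S y ↔ G.componentSetoid S x y :=
  Quotient.eq

theorem component_eq_of_isLink (G : Graph α β) {S : Set β} {e : β} (he : e ∈ S)
    {x y : G.vertexSet} (h : G.IsLink e x y) : G.component S x = G.component S y :=
  G.component_eq_iff.2 (Relation.EqvGen.rel _ _ ⟨e, he, h⟩)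

theorem component_eq_mono (G : Graph α β) {S T : Set β} (h : S ⊆ T) {x y : G.vertexSet}
    (hxy : G.component S x = G.component S y) : G.component T x = G.component T y :=
  G.component_eq_iff.2 (G.componentSetoid_mono h (G.component_eq_iff.1 hxy))

/-- To show that connection in `S` implies an equivalence, check it on the edges. -/
theorem component_eq_induction (G : Graph α β) {S : Set β} (r : Setoid G.vertexSet)
    (h : ∀ e ∈ S, ∀ x y : G.vertexSet, G.IsLink e x y → r x y) {x y : G.vertexSet}
    (hxy : G.component S x = G.component S y) : r x y := by
  have h1 : G.componentSetoid S x y := G.component_eq_iff.1 hxy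
  have h2 : G.componentSetoid S ≤ r := by
    refine Setoid.eqvGen_le ?_
    rintro a b ⟨e, he, hl⟩
    exact h e he a b hl
  exact h2 h1

theorem Spans.mono {G : Graph α β} {S T : Set β} (h : S ⊆ T) {e : β} (he : G.Spans S e) :
    G.Spans T e := by
  obtain ⟨x, y, hl, hc⟩ := he
  exact ⟨x, y, hl, G.component_eq_mono h hc⟩

theorem spans_of_mem {G : Graph α β} {S : Set β} {e : β} (hS : e ∈ S) (hE : e ∈ G.edgeSet) :
    G.Spans S e := by
  obtain ⟨x, y, hl⟩ := G.exists_isLink_of_mem_edgeSet hE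
  exact ⟨⟨x, hl.left_mem⟩, ⟨y, hl.right_mem⟩, hl, G.component_eq_of_isLink hS hl⟩

theorem Spans.component_eq {G : Graph α β} {S : Set β} {e : β} (he : G.Spans S e)
    {x y : G.vertexSet} (hl : G.IsLink e x y) : G.component S x = G.component S y := by
  obtain ⟨a, b, hab, hc⟩ := he
  rcases hab.eq_and_eq_or_eq_and_eq hl with ⟨h1, h2⟩ | ⟨h1, h2⟩
  · rw [Subtype.ext h1, Subtype.ext h2] at hc
    exact hc
  · rw [Subtype.ext h1, Subtype.ext h2] at hc
    exact hc.symm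

theorem Spans.trans {G : Graph α β} {S T : Set β} (h : ∀ f ∈ S, G.Spans T f) {e : β}
    (he : G.Spans S e) : G.Spans T e := by
  obtain ⟨x, y, hl, hc⟩ := he
  refine ⟨x, y, hl, G.component_eq_iff.2 ?_⟩
  refine G.component_eq_induction (G.componentSetoid T) ?_ hc
  intro f hf a b hab
  exact G.component_eq_iff.1 ((h f hf).component_eq hab)

/-- The exchange property of spanning. -/
theorem Spans.exchange {G : Graph α β} {S : Set β} {e f : β} (hf : f ∈ G.edgeSet)
    (h : G.Spans (insert f S) e) (hn : ¬ G.Spans S e) : G.Spans (insert e S) f := by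
  obtain ⟨x, y, hl, hc⟩ := h
  by_contra hcon
  obtain ⟨a, b, hab⟩ := G.exists_isLink_of_mem_edgeSet hf
  have hSe : S ⊆ insert e S := Set.subset_insert _ _
  have hne : ∀ u v : G.vertexSet, G.IsLink f u v →
      G.component (insert e S) u ≠ G.component (insert e S) v := fun u v huv heq =>
    hcon ⟨u, v, huv, heq⟩
  have hxy : G.component (insert e S) x = G.component (insert e S) y :=
    G.component_eq_of_isLink (Set.mem_insert _ _) hl
  let A : G.vertexSet := ⟨a, hab.left_mem⟩
  let B : G.vertexSet := ⟨b, hab.right_mem⟩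
  have hAB : G.IsLink f A B := hab
  -- glue the components of `A` and `B` together
  let φ : G.vertexSet → G.Component S := fun v =>
    open Classical in if G.component S v = G.component S A then G.component S B
      else G.component S v
  have hφ : (Setoid.ker φ) x y := by
    refine G.component_eq_induction (Setoid.ker φ) ?_ hc
    intro g hg u v huv
    change φ u = φ v
    rcases hg with rfl | hg
    · rcases hAB.eq_and_eq_or_eq_and_eq huv with ⟨h1, h2⟩ | ⟨h1, h2⟩
      · rw [← Subtype.ext h1, ← Subtype.ext h2]
        simp only [φ]
        split_ifs <;> simp_all
      · rw [← Subtype.ext h1, ← Subtype.ext h2]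
        simp only [φ]
        split_ifs <;> simp_all
    · have := G.component_eq_of_isLink hg huv
      simp only [φ]
      rw [this]
  have hxy' : G.component S x ≠ G.component S y := fun h => hn ⟨x, y, hl, h⟩
  change φ x = φ y at hφ
  simp only [φ] at hφ
  split_ifs at hφ with h1 h2 h2
  · exact hxy' (h1.trans h2.symm)
  · exact hne A B hAB ((G.component_eq_mono hSe h1).symm.trans
      (hxy.trans (G.component_eq_mono hSe hφ).symm))
  · exact hne A B hAB ((G.component_eq_mono hSe h2).symm.trans
      (hxy.symm.trans (G.component_eq_mono hSe hφ)))
  · exact hxy' hφ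

theorem Spans.exists_finite {G : Graph α β} {S : Set β} {e : β} (h : G.Spans S e) :
    ∃ T ⊆ S, T.Finite ∧ G.Spans T e := by
  obtain ⟨x, y, hl, hc⟩ := h
  have h1 : Relation.EqvGen (fun x y : G.vertexSet => ∃ e ∈ S, G.IsLink e x y) x y :=
    G.component_eq_iff.1 hc
  have key : ∃ T ⊆ S, T.Finite ∧ G.component T x = G.component T y := by
    clear hl hc
    induction h1 with
    | rel u v huv =>
      obtain ⟨g, hg, huv⟩ := huv
      exact ⟨{g}, by simpa using hg, Set.finite_singleton g,
        G.component_eq_of_isLink (Set.mem_singleton g) huv⟩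
    | refl u => exact ⟨∅, Set.empty_subset _, Set.finite_empty, rfl⟩
    | symm u v _ ih =>
      obtain ⟨T, hT, hfin, h⟩ := ih
      exact ⟨T, hT, hfin, h.symm⟩
    | trans u v w _ _ ih1 ih2 =>
      obtain ⟨T, hT, hfin, h⟩ := ih1
      obtain ⟨T', hT', hfin', h'⟩ := ih2
      exact ⟨T ∪ T', Set.union_subset hT hT', hfin.union hfin',
        (G.component_eq_mono Set.subset_union_left h).trans
          (G.component_eq_mono Set.subset_union_right h')⟩
  obtain ⟨T, hT, hfin, h⟩ := key
  exact ⟨T, hT, hfin, x, y, hl, h⟩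

theorem isForest_empty (G : Graph α β) : G.IsForest ∅ :=
  ⟨Set.empty_subset _, fun _ h => h.elim⟩

protected theorem IsForest.subset {G : Graph α β} {I J : Set β} (hJ : G.IsForest J) (h : I ⊆ J) :
    G.IsForest I :=
  ⟨h.trans hJ.1, fun e he hs => hJ.2 e (h he) (hs.mono (Set.sdiff_subset_sdiff_left h))⟩

protected theorem IsForest.insert {G : Graph α β} {I : Set β} (hI : G.IsForest I) {e : β}
    (he : e ∈ G.edgeSet) (hn : ¬ G.Spans I e) : G.IsForest (insert e I) := by
  have heI : e ∉ I := fun h => hn (spans_of_mem h he)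
  refine ⟨Set.insert_subset he hI.1, ?_⟩
  rintro g (rfl | hg) hs
  · exact hn (hs.mono (by simp))
  · have hge : g ≠ e := fun h => heI (h ▸ hg)
    have h1 : insert e I \ {g} = insert e (I \ {g}) := by
      rw [Set.insert_sdiff_of_notMem]
      simpa using hge.symm
    rw [h1] at hs
    refine hn ((hs.exchange he (hI.2 g hg)).mono ?_)
    rw [Set.insert_sdiff_singleton, Set.insert_eq_of_mem hg]

theorem IsForest.ncard_le {G : Graph α β} {I : Set β} (hI : I.Finite) (hIE : I ⊆ G.edgeSet) :
    ∀ (n : ℕ) (J : Set β), G.IsForest J → J.Finite → (∀ e ∈ J, G.Spans I e) →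
      (J \ I).ncard = n → J.ncard ≤ I.ncard := by
  intro n
  induction n with
  | zero =>
    intro J _ hJf _ hc
    have : J \ I = ∅ := (Set.ncard_eq_zero hJf.sdiff).1 hc
    exact Set.ncard_le_ncard (Set.sdiff_eq_empty.1 this) hI
  | succ n ih =>
    intro J hJ hJf hsp hc
    obtain ⟨e, heJ, heI⟩ : (J \ I).Nonempty := by
      rw [← Set.ncard_pos hJf.sdiff]
      omega
    obtain ⟨f, hfI, hfs⟩ : ∃ f ∈ I, ¬ G.Spans (J \ {e}) f := by
      by_contra! hcon
      exact hJ.2 e heJ ((hsp e heJ).trans hcon)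
    have hfJ : f ∉ J \ {e} := fun h => hfs (spans_of_mem h (hIE hfI))
    have hF : G.IsForest (insert f (J \ {e})) :=
      (hJ.subset Set.sdiff_subset).insert (hIE hfI) hfs
    have hcard : (insert f (J \ {e})).ncard = J.ncard := by
      rw [Set.ncard_insert_of_notMem hfJ hJf.sdiff, Set.ncard_sdiff_singleton_add_one heJ hJf]
    rw [← hcard]
    refine ih _ hF (hJf.sdiff.insert f) ?_ ?_
    · rintro g (rfl | hg)
      · exact spans_of_mem hfI (hIE hfI)
      · exact hsp g hg.1
    · have h1 : insert f (J \ {e}) \ I = (J \ I) \ {e} := by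
        ext g
        simp only [Set.mem_sdiff, Set.mem_insert_iff, Set.mem_singleton_iff]
        constructor
        · rintro ⟨rfl | h, h'⟩
          · exact absurd hfI h'
          · exact ⟨⟨h.1, h'⟩, h.2⟩
        · rintro ⟨⟨h, h'⟩, h''⟩
          exact ⟨Or.inr ⟨h, h''⟩, h'⟩
      rw [h1]
      have := Set.ncard_sdiff_singleton_add_one (show e ∈ J \ I from ⟨heJ, heI⟩) hJf.sdiff
      omega

/-- The cycle matroid of `G`: its ground set is the edge set of `G`, its independent sets are the
edge sets of the forests of `G`. -/
def cycleMatroid (G : Graph α β) : Matroid β :=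
  (IndepMatroid.ofFinitaryCardAugment G.edgeSet G.IsForest G.isForest_empty
    (fun _ _ hJ h => hJ.subset h)
    (by
      intro I J hI hIf hJ hJf hlt
      by_contra! hcon
      refine absurd (IsForest.ncard_le hIf hI.1 _ J hJ hJf ?_ rfl) (not_le.2 hlt)
      intro e he
      by_cases heI : e ∈ I
      · exact spans_of_mem heI (hI.1 heI)
      · by_contra hs
        exact hcon e he heI (hI.insert (hJ.1 he) hs))
    (by
      intro I h
      refine ⟨fun e he => (h {e} (by simpa using he) (Set.finite_singleton e)).1 rfl, ?_⟩
      intro e he hs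
      obtain ⟨T, hT, hTf, hTs⟩ := hs.exists_finite
      have heT : e ∉ T := fun h' => (hT h').2 rfl
      refine (h (insert e T) (Set.insert_subset he (hT.trans Set.sdiff_subset))
        (hTf.insert e)).2 e (Set.mem_insert _ _) (hTs.mono ?_)
      intro g hg
      exact ⟨Or.inr hg, fun h' => heT (h' ▸ hg)⟩)
    (fun _ h => h.1)).matroid

/-! ### Reduced chromatic cohomology -/

/-- A reduced enhanced state of the graph `G` with base point `r`: a state, that is, a spanning
subgraph, given by its edge set, together with a colouring of its connected components in the two
colours `x` and `1`, given by the set of the components coloured `x`, in which the component of the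
base point is coloured `x`. -/
@[ext]
structure ReducedEnhancedState (G : Graph α β) (r : G.vertexSet) where
  /-- The edges of the state. -/
  edges : Set β
  edges_subset : edges ⊆ G.edgeSet
  /-- The components of the state that are coloured `x`; all others are coloured `1`. -/
  xComponents : Set (G.Component edges)
  base_mem : G.component edges r ∈ xComponents

namespace ReducedEnhancedState

variable {G : Graph α β} {r : G.vertexSet}

/-- The dimension of a state: its number of edges. -/
noncomputable def dimension (s : G.ReducedEnhancedState r) : ℤ := s.edges.ncard

/-- The degree of an enhanced state: the number of its components coloured `x`, minus one. -/
noncomputable def degree (s : G.ReducedEnhancedState r) : ℤ := s.xComponents.ncard - 1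

/-- Adding `e` to the state joins two different components that are both coloured `x`. -/
def JoinsXX (s : G.ReducedEnhancedState r) (e : β) : Prop :=
  ∃ v w : G.vertexSet, G.IsLink e v w ∧ G.component s.edges v ≠ G.component s.edges w ∧
    G.component s.edges v ∈ s.xComponents ∧ G.component s.edges w ∈ s.xComponents

/-- The state obtained by adding an edge `e` of `G`. A component of the new state is coloured `x`
if and only if it contains a component of the old state that is coloured `x`. So components that
do not change keep their colour, and if `e` joins two different components, then the colours of
these are multiplied by the rule `1 * 1 = 1`, `1 * x = x * 1 = x`. (The remaining case `x * x = 0`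
is the one of `JoinsXX`, and is treated in `differentialSummand`.) -/
def addEdge (s : G.ReducedEnhancedState r) (e : β) (he : e ∈ G.edgeSet) :
    G.ReducedEnhancedState r where
  edges := insert e s.edges
  edges_subset := Set.insert_subset he s.edges_subset
  xComponents := G.componentMap (Set.subset_insert e s.edges) '' s.xComponents
  base_mem := ⟨G.component s.edges r, s.base_mem, rfl⟩

open Classical in
/-- The contribution of an edge `e` of `G` outside the state `s` to the differential of `s`: zero
if two components coloured `x` are joined, otherwise `s ∪ e` with the sign `(-1) ^ k`, where `k` is
the number of the edges of `s` that are smaller than `e`. -/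
noncomputable def differentialSummand [LinearOrder β]
    (s : G.ReducedEnhancedState r) (e : β) (he : e ∈ G.edgeSet) :
    G.ReducedEnhancedState r →₀ ℝ :=
  if s.JoinsXX e then 0
  else Finsupp.single (s.addEdge e he) ((-1) ^ {f ∈ s.edges | f < e}.ncard)

end ReducedEnhancedState

/-- The cochain group of bidegree `(i, j)`: the real vector space spanned by the reduced
enhanced states of dimension `i` and degree `j`. -/
noncomputable def reducedCochainGroup (G : Graph α β) (r : G.vertexSet)
    (i j : ℤ) : Submodule ℝ (G.ReducedEnhancedState r →₀ ℝ) :=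
  Finsupp.supported ℝ ℝ {s | s.dimension = i ∧ s.degree = j}

/-- The differential: the sum, over all edges of the (finite) graph that do not belong to the
state, of the contributions of these edges. -/
noncomputable def reducedDifferential [LinearOrder β] (G : Graph α β) (r : G.vertexSet) :
    (G.ReducedEnhancedState r →₀ ℝ) →ₗ[ℝ] (G.ReducedEnhancedState r →₀ ℝ) :=
  Finsupp.linearCombination ℝ fun s : G.ReducedEnhancedState r =>
    ∑ᶠ e : {e : β // e ∈ G.edgeSet ∧ e ∉ s.edges}, s.differentialSummand e.1 e.2.1

/-- The cocycles of bidegree `(i, j)`: the kernel of the differential on the `(i, j)`-th cochain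
group. -/
noncomputable def reducedCocycles [LinearOrder β] (G : Graph α β) (r : G.vertexSet)
    (i j : ℤ) : Submodule ℝ (G.ReducedEnhancedState r →₀ ℝ) :=
  G.reducedCochainGroup r i j ⊓ LinearMap.ker (G.reducedDifferential r)

/-- The coboundaries of bidegree `(i, j)`: the image under the differential of the `(i - 1, j)`-th
cochain group. -/
noncomputable def reducedCoboundaries [LinearOrder β] (G : Graph α β) (r : G.vertexSet)
    (i j : ℤ) : Submodule ℝ (G.ReducedEnhancedState r →₀ ℝ) :=
  (G.reducedCochainGroup r (i - 1) j).map (G.reducedDifferential r)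

/-- The reduced chromatic cohomology group of bidegree `(i, j)` of the graph `G` with base point
`r`: cocycles modulo coboundaries. -/
abbrev ReducedCohomology [LinearOrder β] (G : Graph α β)
    (r : G.vertexSet) (i j : ℤ) : Type _ :=
  G.reducedCocycles r i j ⧸
    (G.reducedCoboundaries r i j).submoduleOf (G.reducedCocycles r i j)

end Graph

/-- Two matroids are isomorphic if there is a bijection between their ground sets that preserves
independence in both directions. -/
def Matroid.IsIsomorphic {β β' : Type*} (M : Matroid β) (M' : Matroid β') : Prop :=
  ∃ φ : M.E ≃ M'.E, ∀ I : Set M.E,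
    M.Indep (Subtype.val '' I) ↔ M'.Indep (Subtype.val '' (φ '' I))

/-! Give every vertex a variable of square zero. The states with edge set `S` form a basis of the
algebra in these variables modulo the base variable and the differences of the ends of the edges of
`S`: a state is the product of the variables of its `x`-components other than the base component.
The rule `x * x = 0` is the vanishing square, and the differential is a signed sum of quotient maps.
Dually, the summands become subspaces of the linear forms on one fixed algebra (`dualSummand`), and
the boundary becomes a signed sum of inclusions (`dualBoundary`).

The main point is that the cohomology of a connected graph lives on the diagonal `i + j = |V| - 1`.
This is proved for the dual complex in `exists_dualBoundary_eq`, by deletion and contraction of the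
smallest edge `e`: the complex is the cone of the inclusion of the complex of the contraction into
that of the deletion. If `e` is a loop, the inclusion is an equality and the cone is acyclic. If `e`
is neither a loop nor a bridge, induction applies to both minors. If `e` is a bridge, the deletion
is disconnected, but the quotient of the two complexes is again that of the contraction, one degree
lower, up to a change of signs on one side of the bridge. The pairing of chains with cochains
carries exactness back (`reducedCocycles_le_reducedCoboundaries`).

The rest is counting. For connected graphs the matroid determines the number of components of every
edge set, hence the dimensions of all cochain groups (`finrank_reducedCochainGroup_eq`). Off the
diagonal, cocycles are coboundaries, so the dimensions of the coboundaries in positions `i` and `i +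
1` add up to that of the cochains in position `i`. For fixed `j` this fails for at most one `i`.
Since the coboundaries vanish far out, working inwards from both ends determines all dimensions. -/

/-! ### Linear forms on the algebra of square-zero variables. -/

section Contraction

variable {V : Type*}

open scoped Classical in
/-- The operator that is dual to the contraction with the elements of the class `K`. -/
noncomputable def classMul (K : Set V) : (Finset V → ℝ) →ₗ[ℝ] (Finset V → ℝ) where
  toFun f U := if (U.filter (· ∈ K)).card = 1 then f (U.filter (· ∉ K)) else 0
  map_add' f g := by ext U; by_cases h : (U.filter (· ∈ K)).card = 1 <;> simp [h]
  map_smul' a f := by ext U; by_cases h : (U.filter (· ∈ K)).card = 1 <;> simp [h]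

open scoped Classical in
theorem classMul_apply (K : Set V) (f : Finset V → ℝ) (U : Finset V) :
    classMul K f U =
      if (U.filter (· ∈ K)).card = 1 then f (U.filter (· ∉ K)) else 0 := rfl

open scoped Classical in
/-- The change of the sign of the variables in `K`. -/
noncomputable def signFlip (K : Set V) : (Finset V → ℝ) →ₗ[ℝ] (Finset V → ℝ) where
  toFun f U := (-1) ^ (U.filter (· ∈ K)).card * f U
  map_add' f g := by ext U; simp [mul_add]
  map_smul' a f := by ext U; simp [mul_left_comm]

open scoped Classical in
theorem signFlip_apply (K : Set V) (f : Finset V → ℝ) (U : Finset V) :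
    signFlip K f U = (-1) ^ (U.filter (· ∈ K)).card * f U := rfl

theorem signFlip_signFlip (K : Set V) (f : Finset V → ℝ) : signFlip K (signFlip K f) = f := by
  ext U
  rw [signFlip_apply, signFlip_apply, ← mul_assoc, ← mul_pow]
  simp

variable [DecidableEq V]

/-- The transpose of the multiplication by the variable `v` on the algebra generated by the
variables `V` with square zero, whose linear forms are given by their values on the square-free
monomials. -/
def contraction (v : V) : (Finset V → ℝ) →ₗ[ℝ] (Finset V → ℝ) where
  toFun f U := if v ∈ U then 0 else f (insert v U)
  map_add' f g := by ext U; by_cases h : v ∈ U <;> simp [h]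
  map_smul' a f := by ext U; by_cases h : v ∈ U <;> simp [h]

theorem contraction_apply (v : V) (f : Finset V → ℝ) (U : Finset V) :
    contraction v f U = if v ∈ U then 0 else f (insert v U) := rfl

theorem contraction_comm (v w : V) (f : Finset V → ℝ) :
    contraction v (contraction w f) = contraction w (contraction v f) := by
  ext U
  simp only [contraction_apply, Finset.mem_insert]
  rcases eq_or_ne v w with rfl | h
  · rfl
  · rw [Finset.insert_comm]
    by_cases hv : v ∈ U <;> by_cases hw : w ∈ U <;> simp [hv, hw, h, h.symm]

theorem contraction_contraction_self (v : V) (f : Finset V → ℝ) :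
    contraction v (contraction v f) = 0 := by
  ext U
  simp [contraction_apply]

theorem apply_eq_contraction {v : V} {U : Finset V} (h : v ∈ U) (f : Finset V → ℝ) :
    f U = contraction v f (U.erase v) := by
  simp [contraction_apply, Finset.insert_erase h]

/-- If two contractions agree on `f`, then `f` vanishes at the sets that contain both points. -/
theorem apply_eq_zero_of_contraction_eq {f : Finset V → ℝ} {v w : V} (hvw : v ≠ w)
    (h : contraction v f = contraction w f) {U : Finset V} (hv : v ∈ U) (hw : w ∈ U) :
    f U = 0 := by
  rw [apply_eq_contraction hv f, h, contraction_apply, if_pos]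
  simp [hw, hvw.symm]

-- For `v ∉ U`, the set `insert v U` meets `K` exactly once if and only if `U` misses `K`. The
-- right-hand side does not depend on `v`, so all elements of `K` contract `classMul K f` in the
-- same way.
open scoped Classical in
theorem contraction_classMul_of_mem {K : Set V} {v : V} (hv : v ∈ K) (f : Finset V → ℝ)
    (U : Finset V) :
    contraction v (classMul K f) U = if U.filter (· ∈ K) = ∅ then f U else 0 := by
  rw [contraction_apply, classMul_apply]
  by_cases h : v ∈ U
  · rw [if_pos h, if_neg]
    exact Finset.ne_empty_of_mem (Finset.mem_filter.2 ⟨h, hv⟩)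
  · have h1 : (insert v U).filter (· ∈ K) = insert v (U.filter (· ∈ K)) := by
      rw [Finset.filter_insert, if_pos hv]
    have h2 : (insert v U).filter (· ∉ K) = U.filter (· ∉ K) := by
      rw [Finset.filter_insert, if_neg (not_not.2 hv)]
    rw [if_neg h, h1, h2, Finset.card_insert_of_notMem (by simp [h])]
    by_cases hU : U.filter (· ∈ K) = ∅
    · rw [if_pos (by simp [hU]), if_pos hU]
      congr 1
      rw [Finset.filter_eq_self]
      intro x hx hxK
      exact Finset.notMem_empty x (hU ▸ Finset.mem_filter.2 ⟨hx, hxK⟩)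
    · rw [if_neg hU, if_neg]
      simpa using hU

theorem contraction_classMul_of_notMem {K : Set V} {v : V} (hv : v ∉ K) (f : Finset V → ℝ) :
    contraction v (classMul K f) = classMul K (contraction v f) := by
  classical
  ext U
  simp only [contraction_apply, classMul_apply, Finset.filter_insert,
    Finset.mem_filter, hv, not_false_eq_true, and_true]
  by_cases h : v ∈ U <;> simp [h]

/-- If the variables in `K` act on `f` as a single variable `y`, then `classMul K` is the transpose
of the derivative by `y`, and this is the identity `∂y + y∂ = 1` on polynomials modulo `y ^ 2`. The
first term accounts for the sets that miss `K`, the second for those that meet it once; on all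
others `f` vanishes. -/
theorem contraction_classMul_add {K : Set V} {a : V} (ha : a ∈ K) {f : Finset V → ℝ}
    (hf : ∀ v ∈ K, contraction v f = contraction a f) :
    contraction a (classMul K f) + classMul K (contraction a f) = f := by
  classical
  ext U
  rw [Pi.add_apply, contraction_classMul_of_mem ha, classMul_apply]
  by_cases h0 : U.filter (· ∈ K) = ∅
  · simp [h0]
  rw [if_neg h0, zero_add]
  split_ifs with h1
  · obtain ⟨u, hu⟩ := Finset.card_eq_one.1 h1
    have huU : u ∈ U.filter (· ∈ K) := by simp [hu]
    rw [Finset.mem_filter] at huU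
    rw [apply_eq_contraction huU.1 f, hf u huU.2]
    refine congrArg (contraction a f) (Finset.ext fun x => ?_)
    have : x ∈ U.filter (· ∈ K) ↔ x = u := by simp [hu]
    simp only [Finset.mem_filter, Finset.mem_erase] at this ⊢
    tauto
  · have h2 : 1 < (U.filter (· ∈ K)).card := by
      have := Finset.card_pos.2 (Finset.nonempty_iff_ne_empty.2 h0)
      omega
    obtain ⟨x, hx, y, hy, hxy⟩ := Finset.one_lt_card.1 h2
    rw [Finset.mem_filter] at hx hy
    exact (apply_eq_zero_of_contraction_eq hxy ((hf x hx.2).trans (hf y hy.2).symm) hx.1 hy.1).symm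

theorem contraction_signFlip_of_mem {K : Set V} {v : V} (hv : v ∈ K) (f : Finset V → ℝ) :
    contraction v (signFlip K f) = -signFlip K (contraction v f) := by
  classical
  ext U
  by_cases h : v ∈ U
  · simp [contraction_apply, signFlip_apply, h]
  · simp [contraction_apply, signFlip_apply, h, hv, Finset.filter_insert, pow_succ]

theorem contraction_signFlip_of_notMem {K : Set V} {v : V} (hv : v ∉ K) (f : Finset V → ℝ) :
    contraction v (signFlip K f) = signFlip K (contraction v f) := by
  classical
  ext U
  by_cases h : v ∈ U
  · simp [contraction_apply, signFlip_apply, h]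
  · simp [contraction_apply, signFlip_apply, h, hv, Finset.filter_insert]

end Contraction

namespace Graph

/-! ### How the components change when an edge is added. -/

section Components

variable {α β : Type*} {G : Graph α β}

open scoped Classical in
/-- Adding an edge with ends `x` and `y` joins the components of `x` and `y`, and no others. -/
theorem component_insert_eq_iff {S : Set β} {e : β} {x y : G.vertexSet} (hl : G.IsLink e x y)
    {u v : G.vertexSet} :
    G.component (insert e S) u = G.component (insert e S) v ↔
      (if G.component S u = G.component S y then G.component S x else G.component S u) =
      (if G.component S v = G.component S y then G.component S x else G.component S v) := by
  have hS : S ⊆ insert e S := Set.subset_insert _ _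
  constructor
  · intro h
    refine G.component_eq_induction (Setoid.ker fun v : G.vertexSet =>
      if G.component S v = G.component S y then G.component S x else G.component S v) ?_ h
    rintro g (rfl | hg) a b hab
    · rw [Setoid.ker_def]
      rcases hl.eq_and_eq_or_eq_and_eq hab with ⟨h1, h2⟩ | ⟨h1, h2⟩ <;>
      · rw [← Subtype.ext h1, ← Subtype.ext h2]
        split_ifs <;> simp_all
    · rw [Setoid.ker_def, G.component_eq_of_isLink hg hab]
  · have hxy : G.component (insert e S) x = G.component (insert e S) y :=
      G.component_eq_of_isLink (Set.mem_insert _ _) hl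
    -- The glued value is itself a component of `S`; it has a representative that is connected to
    -- `w` once `e` is present.
    have key : ∀ w : G.vertexSet, ∃ w' : G.vertexSet,
        (if G.component S w = G.component S y then G.component S x else G.component S w) =
          G.component S w' ∧ G.component (insert e S) w' = G.component (insert e S) w := by
      intro w
      split_ifs with hw
      · exact ⟨x, rfl, hxy.trans (G.component_eq_mono hS hw).symm⟩
      · exact ⟨w, rfl, rfl⟩
    intro h
    obtain ⟨u', hu, hu'⟩ := key u
    obtain ⟨v', hv, hv'⟩ := key v
    rw [hu, hv] at h
    exact hu'.symm.trans ((G.component_eq_mono hS h).trans hv')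

theorem component_insert_eq_iff_of_spans {S : Set β} {e : β} (h : G.Spans S e)
    {u v : G.vertexSet} :
    G.component (insert e S) u = G.component (insert e S) v ↔
      G.component S u = G.component S v := by
  classical
  obtain ⟨x, y, hl, hxy⟩ := h
  rw [component_insert_eq_iff hl]
  simp only [hxy]
  constructor
  · intro h
    split_ifs at h <;> simp_all
  · intro h
    rw [h]

theorem component_surjective (S : Set β) : Function.Surjective (G.component S) :=
  Quotient.mk_surjective

theorem finite_component (hV : G.vertexSet.Finite) (S : Set β) : Finite (G.Component S) :=
  have := hV.to_subtype
  Finite.of_surjective _ (component_surjective S)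

theorem card_component_insert_of_spans {S : Set β} {e : β} (h : G.Spans S e) :
    Nat.card (G.Component (insert e S)) = Nat.card (G.Component S) := by
  symm
  refine Nat.card_eq_of_bijective (G.componentMap (Set.subset_insert e S)) ⟨?_, ?_⟩
  · intro a b
    obtain ⟨u, rfl⟩ := component_surjective S a
    obtain ⟨v, rfl⟩ := component_surjective S b
    exact (component_insert_eq_iff_of_spans h).1
  · intro a
    obtain ⟨u, rfl⟩ := component_surjective _ a
    exact ⟨G.component S u, rfl⟩

theorem card_component_insert_of_not_spans (hV : G.vertexSet.Finite) {S : Set β} {e : β}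
    (he : e ∈ G.edgeSet) (h : ¬ G.Spans S e) :
    Nat.card (G.Component (insert e S)) + 1 = Nat.card (G.Component S) := by
  classical
  have := finite_component hV S
  obtain ⟨x₀, y₀, hl₀⟩ := G.exists_isLink_of_mem_edgeSet he
  obtain ⟨x, y, hl⟩ : ∃ x y : G.vertexSet, G.IsLink e x y :=
    ⟨⟨x₀, hl₀.left_mem⟩, ⟨y₀, hl₀.right_mem⟩, hl₀⟩
  have hxy : G.component S x ≠ G.component S y := fun hxy => h ⟨x, y, hl, hxy⟩
  -- The component of `y` is absorbed into that of `x`; the others represent each new component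
  -- exactly once.
  have hbij : Function.Bijective fun c : {c : G.Component S // c ≠ G.component S y} =>
      G.componentMap (Set.subset_insert e S) c.1 := by
    constructor
    · rintro ⟨a, ha⟩ ⟨b, hb⟩ hab
      obtain ⟨u, rfl⟩ := component_surjective S a
      obtain ⟨v, rfl⟩ := component_surjective S b
      have hab' : G.component (insert e S) u = G.component (insert e S) v := hab
      have := (component_insert_eq_iff hl).1 hab'
      rw [if_neg ha, if_neg hb] at this
      exact Subtype.ext this
    · intro a
      obtain ⟨u, rfl⟩ := component_surjective _ a
      by_cases hu : G.component S u = G.component S y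
      · refine ⟨⟨G.component S x, hxy⟩, ?_⟩
        change G.component (insert e S) x = G.component (insert e S) u
        rw [component_insert_eq_iff hl, if_neg hxy, if_pos hu]
      · exact ⟨⟨G.component S u, hu⟩, rfl⟩
  have h1 : Nat.card {c : G.Component S // c ≠ G.component S y} = Nat.card (G.Component S) - 1 := by
    have := Fintype.ofFinite (G.Component S)
    rw [Nat.card_eq_fintype_card, Nat.card_eq_fintype_card, Fintype.card_subtype_compl,
      Fintype.card_subtype_eq]
  have h2 : 0 < Nat.card (G.Component S) :=
    have : Nonempty (G.Component S) := ⟨G.component S x⟩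
    Nat.card_pos
  rw [← Nat.card_eq_of_bijective _ hbij, h1]
  omega

theorem card_component_empty : Nat.card (G.Component ∅) = Nat.card G.vertexSet := by
  symm
  refine Nat.card_eq_of_bijective (G.component ∅) ⟨fun u v h => ?_, component_surjective _⟩
  exact G.component_eq_induction (⊥ : Setoid G.vertexSet) (fun e he => he.elim) h

theorem card_component_eq_one {S : Set β} (r : G.vertexSet)
    (h : ∀ v w, G.component S v = G.component S w) : Nat.card (G.Component S) = 1 := by
  rw [Nat.card_eq_one_iff_unique]
  refine ⟨⟨fun a b => ?_⟩, ⟨G.component S r⟩⟩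
  obtain ⟨u, rfl⟩ := component_surjective S a
  obtain ⟨v, rfl⟩ := component_surjective S b
  exact h u v

end Components

/-! ### The dual complex of a minor. -/

section DualComplex

variable {α β : Type*} {G : Graph α β}

open scoped Classical in
/-- The dual of the summand of the reduced cochain complex that belongs to the edge set `S`. -/
noncomputable def dualSummand (G : Graph α β) (r : G.vertexSet) (S : Set β) :
    Submodule ℝ (Finset G.vertexSet → ℝ) where
  carrier := {f | contraction r f = 0 ∧ ∀ e ∈ S, ∀ x y : G.vertexSet, G.IsLink e x y →
    contraction x f = contraction y f}
  add_mem' := by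
    rintro f g ⟨hf, hf'⟩ ⟨hg, hg'⟩
    refine ⟨by rw [map_add, hf, hg, add_zero], fun e he x y h => ?_⟩
    rw [map_add, map_add, hf' e he x y h, hg' e he x y h]
  zero_mem' := ⟨map_zero _, fun e he x y h => by rw [map_zero, map_zero]⟩
  smul_mem' := by
    rintro a f ⟨hf, hf'⟩
    refine ⟨by rw [map_smul, hf, smul_zero], fun e he x y h => ?_⟩
    rw [map_smul, map_smul, hf' e he x y h]

variable {r : G.vertexSet}

theorem dualSummand_anti {S T : Set β} (h : S ⊆ T) : G.dualSummand r T ≤ G.dualSummand r S :=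
  fun _ hf => ⟨hf.1, fun e he => hf.2 e (h he)⟩

open scoped Classical in
theorem contraction_eq_of_component_eq {S : Set β} {f : Finset G.vertexSet → ℝ}
    (hf : f ∈ G.dualSummand r S) {u v : G.vertexSet} (h : G.component S u = G.component S v) :
    contraction u f = contraction v f :=
  G.component_eq_induction (Setoid.ker fun v => contraction v f)
    (fun e he x y hxy => hf.2 e he x y hxy) h

open scoped Classical in
theorem contraction_eq_zero_of_component_eq {S : Set β} {f : Finset G.vertexSet → ℝ}
    (hf : f ∈ G.dualSummand r S) {u : G.vertexSet} (h : G.component S u = G.component S r) :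
    contraction u f = 0 :=
  (contraction_eq_of_component_eq hf h).trans hf.1

open scoped Classical in
theorem contraction_mem_dualSummand {S : Set β} {f : Finset G.vertexSet → ℝ}
    (hf : f ∈ G.dualSummand r S) (v : G.vertexSet) : contraction v f ∈ G.dualSummand r S := by
  refine ⟨by rw [contraction_comm, hf.1, map_zero], fun e he x y h => ?_⟩
  rw [contraction_comm, hf.2 e he x y h, contraction_comm]

open scoped Classical in
theorem mem_dualSummand_insert {S : Set β} {e : β} {x y : G.vertexSet} (hl : G.IsLink e x y)
    {f : Finset G.vertexSet → ℝ} :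
    f ∈ G.dualSummand r (insert e S) ↔
      f ∈ G.dualSummand r S ∧ contraction x f = contraction y f := by
  constructor
  · intro hf
    exact ⟨dualSummand_anti (Set.subset_insert _ _) hf, hf.2 e (Set.mem_insert _ _) x y hl⟩
  · rintro ⟨hf, hxy⟩
    refine ⟨hf.1, ?_⟩
    rintro g (rfl | hg) u v huv
    · rcases hl.eq_and_eq_or_eq_and_eq huv with ⟨h1, h2⟩ | ⟨h1, h2⟩
      · rw [← Subtype.ext h1, ← Subtype.ext h2, hxy]
      · rw [← Subtype.ext h1, ← Subtype.ext h2, hxy]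
    · exact hf.2 g hg u v huv

/-- The relation imposed by `e` already follows from those imposed by `S`. This makes the cone
acyclic when `e` is a loop of the contraction. -/
theorem mem_dualSummand_insert_of_spans {S : Set β} {e : β} (h : G.Spans S e)
    {f : Finset G.vertexSet → ℝ} (hf : f ∈ G.dualSummand r S) :
    f ∈ G.dualSummand r (insert e S) := by
  obtain ⟨x, y, hl, hxy⟩ := h
  exact (mem_dualSummand_insert hl).2 ⟨hf, contraction_eq_of_component_eq hf hxy⟩

-- Since `b` lies outside the class of `a`, its contraction commutes with `classMul`, and the
-- hypothesis replaces `contraction b f` by `-contraction a f`. What remains is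
-- `contraction_classMul_add`.
open scoped Classical in
theorem contraction_classMul_sub {S : Set β} {f : Finset G.vertexSet → ℝ}
    (hf : f ∈ G.dualSummand r S) {a b : G.vertexSet} (hab : G.component S a ≠ G.component S b)
    (hfab : contraction a f + contraction b f = 0) :
    contraction a (classMul {v | G.component S v = G.component S a} f) -
      contraction b (classMul {v | G.component S v = G.component S a} f) = f := by
  rw [contraction_classMul_of_notMem (v := b) hab.symm, sub_eq_add_neg, ← map_neg,
    ← eq_neg_of_add_eq_zero_left hfab]
  exact contraction_classMul_add (by simp) fun v hv => contraction_eq_of_component_eq hf hv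

-- The class must avoid the base point: then the contraction with `r` commutes with `classMul` and
-- still gives zero.
open scoped Classical in
theorem classMul_mem_dualSummand {S : Set β} {f : Finset G.vertexSet → ℝ}
    (hf : f ∈ G.dualSummand r S) {a : G.vertexSet} (har : G.component S a ≠ G.component S r) :
    classMul {v | G.component S v = G.component S a} f ∈ G.dualSummand r S := by
  refine ⟨?_, fun e he x y hl => ?_⟩
  · rw [contraction_classMul_of_notMem (v := r) har.symm, hf.1, map_zero]
  · have hxy := G.component_eq_of_isLink he hl
    by_cases hx : G.component S x = G.component S a
    · ext U
      rw [contraction_classMul_of_mem (v := x) hx, contraction_classMul_of_mem (v := y) (hxy.symm.trans hx)]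
    · have hy : ¬ G.component S y = G.component S a := fun h => hx (hxy.trans h)
      rw [contraction_classMul_of_notMem (v := x) hx, contraction_classMul_of_notMem (v := y) hy,
        hf.2 e he x y hl]

theorem classMul_apply_eq_zero {V : Type*} {K : Set V} {f : Finset V → ℝ} {j : ℤ}
    (hf : ∀ U : Finset V, (U.card : ℤ) ≠ j → f U = 0) (U : Finset V) (hU : (U.card : ℤ) ≠ j + 1) :
    classMul K f U = 0 := by
  classical
  rw [classMul_apply]
  split_ifs with h
  · apply hf
    have := Finset.card_filter_add_card_filter_not (s := U) (· ∈ K)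
    omega
  · rfl

open scoped Classical in
/-- On the dual summand of `S`, the kernel of the sum of the contractions with two vertices
from different components is the image of their difference. -/
theorem exists_contraction_sub_eq {S : Set β} {f : Finset G.vertexSet → ℝ} {j : ℤ}
    (hf : f ∈ G.dualSummand r S) (hj : ∀ U, (U.card : ℤ) ≠ j → f U = 0) {a b : G.vertexSet}
    (hab : G.component S a ≠ G.component S b) (hfab : contraction a f + contraction b f = 0) :
    ∃ g ∈ G.dualSummand r S, (∀ U, (U.card : ℤ) ≠ j + 1 → g U = 0) ∧
      contraction a g - contraction b g = f := by
  -- At least one of the two components misses the base point; `classMul` is taken with that one,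
  -- with the opposite sign if it is the component of `b`.
  by_cases har : G.component S a = G.component S r
  · refine ⟨-classMul {v | G.component S v = G.component S b} f,
      neg_mem (classMul_mem_dualSummand hf fun h => hab (har.trans h.symm)), fun U hU => ?_, ?_⟩
    · rw [Pi.neg_apply, classMul_apply_eq_zero hj U hU, neg_zero]
    · rw [map_neg, map_neg, sub_neg_eq_add, neg_add_eq_sub]
      exact contraction_classMul_sub hf hab.symm ((add_comm _ _).trans hfab)
  · exact ⟨_, classMul_mem_dualSummand hf har, classMul_apply_eq_zero hj,
      contraction_classMul_sub hf hab hfab⟩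

/-- The change of the signs of the variables in a union of components of `T` preserves the dual
summands of the subsets of `T`. -/
theorem signFlip_mem_dualSummand {S T : Set β} (hST : S ⊆ T) (b : G.vertexSet)
    {f : Finset G.vertexSet → ℝ} (hf : f ∈ G.dualSummand r S) :
    signFlip {v | G.component T v = G.component T b} f ∈ G.dualSummand r S := by
  classical
  refine ⟨?_, fun e he x y hl => ?_⟩
  · by_cases h : G.component T r = G.component T b
    · rw [contraction_signFlip_of_mem (v := r) h, hf.1, map_zero, neg_zero]
    · rw [contraction_signFlip_of_notMem (v := r) h, hf.1, map_zero]
  · have hxy := G.component_eq_of_isLink (hST he) hl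
    by_cases h : G.component T x = G.component T b
    · rw [contraction_signFlip_of_mem (v := x) h,
        contraction_signFlip_of_mem (v := y) (hxy.symm.trans h), hf.2 e he x y hl]
    · rw [contraction_signFlip_of_notMem (v := x) h,
        contraction_signFlip_of_notMem (v := y) fun h' => h (hxy.trans h'), hf.2 e he x y hl]

/-- The chains of bidegree `(i, j)` of the dual complex of the minor of `G` that is obtained by
contracting the edges in `B` and keeping only the edges in `L`. -/
noncomputable def dualChainGroup (G : Graph α β) (r : G.vertexSet) (B : Set β) (L : Finset β)
    (i j : ℤ) : Submodule ℝ (Set β → Finset G.vertexSet → ℝ) where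
  carrier := {c | ∀ S, c S ∈ G.dualSummand r (B ∪ S) ∧
    ∀ U, ¬ (S ⊆ L ∧ S.ncard = i ∧ U.card = j) → c S U = 0}
  add_mem' := fun {c d} hc hd S => ⟨add_mem (hc S).1 (hd S).1, fun U h => by
    rw [Pi.add_apply, Pi.add_apply, (hc S).2 U h, (hd S).2 U h, add_zero]⟩
  zero_mem' := fun S => ⟨zero_mem _, fun U h => rfl⟩
  smul_mem' := fun a c hc S => ⟨Submodule.smul_mem _ a (hc S).1, fun U h => by
    rw [Pi.smul_apply, Pi.smul_apply, (hc S).2 U h, smul_zero]⟩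

theorem eq_zero_of_mem_dualChainGroup {B : Set β} {L : Finset β} {i j : ℤ}
    {c : Set β → Finset G.vertexSet → ℝ} (hc : c ∈ G.dualChainGroup r B L i j) {S : Set β}
    (hS : ¬ S ⊆ L) : c S = 0 :=
  funext fun U => (hc S).2 U fun h => hS h.1

open scoped Classical in
/-- The boundary operator of the dual complex. -/
noncomputable def dualBoundary [LinearOrder β] {M : Type*} [AddCommGroup M] [Module ℝ M]
    (L : Finset β) : (Set β → M) →ₗ[ℝ] (Set β → M) where
  toFun c S := ∑ e ∈ L.filter (· ∉ S), (-1 : ℝ) ^ {f ∈ S | f < e}.ncard • c (insert e S)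
  map_add' c d := by ext S; simp [Finset.sum_add_distrib]
  map_smul' a c := by ext S; simp [Finset.smul_sum, smul_comm a]

open scoped Classical in
theorem dualBoundary_apply [LinearOrder β] {M : Type*} [AddCommGroup M] [Module ℝ M]
    (L : Finset β) (c : Set β → M) (S : Set β) :
    dualBoundary L c S =
      ∑ e ∈ L.filter (· ∉ S), (-1 : ℝ) ^ {f ∈ S | f < e}.ncard • c (insert e S) := rfl

theorem dualBoundary_comp [LinearOrder β] {M N : Type*} [AddCommGroup M] [Module ℝ M]
    [AddCommGroup N] [Module ℝ N] (φ : M →ₗ[ℝ] N) (L : Finset β) (c : Set β → M) :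
    dualBoundary L (fun S => φ (c S)) = fun S => φ (dualBoundary L c S) := by
  ext S
  simp [dualBoundary_apply]

theorem dualBoundary_mem [LinearOrder β] {B : Set β} {L : Finset β} {i j : ℤ}
    {c : Set β → Finset G.vertexSet → ℝ} (hc : c ∈ G.dualChainGroup r B L (i + 1) j) :
    dualBoundary L c ∈ G.dualChainGroup r B L i j := by
  classical
  refine fun S => ⟨?_, fun U hU => ?_⟩
  · rw [dualBoundary_apply]
    refine sum_mem fun e _ => Submodule.smul_mem _ _ ?_
    exact dualSummand_anti (Set.union_subset_union_right _ (Set.subset_insert _ _)) (hc _).1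
  · rw [dualBoundary_apply, Finset.sum_apply]
    refine Finset.sum_eq_zero fun e he => ?_
    rw [Pi.smul_apply, (hc _).2, smul_zero]
    rintro ⟨h1, h2, h3⟩
    have hS : S ⊆ L := (Set.subset_insert _ _).trans h1
    refine hU ⟨hS, ?_, h3⟩
    rw [Set.ncard_insert_of_notMem (Finset.mem_filter.1 he).2 (L.finite_toSet.subset hS)] at h2
    push_cast at h2
    omega

end DualComplex

/-! ### Splitting off one edge: the complex as a mapping cone. -/

section Glue

variable {α β : Type*} {G : Graph α β} {r : G.vertexSet}

open scoped Classical in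
/-- The chain whose values at the sets without and with the element `e` are given. -/
noncomputable def glue {M : Type*} (e : β) (c d : Set β → M) (S : Set β) : M :=
  if e ∈ S then d (S \ {e}) else c S

theorem glue_of_mem {M : Type*} {e : β} (c d : Set β → M) {S : Set β} (h : e ∈ S) :
    glue e c d S = d (S \ {e}) := if_pos h

theorem glue_of_notMem {M : Type*} {e : β} (c d : Set β → M) {S : Set β} (h : e ∉ S) :
    glue e c d S = c S := if_neg h

/-- The component `c` belongs to the deletion of `e`, the component `d` to its contraction. The
dimension of `d` is one lower because `e` is no longer counted. -/
theorem glue_mem_dualChainGroup [DecidableEq β] {B : Set β} {L : Finset β} {e : β} {i j : ℤ}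
    {c d : Set β → Finset G.vertexSet → ℝ} (hc : c ∈ G.dualChainGroup r B L (i + 1) j)
    (hd : d ∈ G.dualChainGroup r (insert e B) L i j) :
    glue e c d ∈ G.dualChainGroup r B (insert e L) (i + 1) j := by
  intro S
  by_cases h : e ∈ S
  · rw [glue_of_mem _ _ h]
    refine ⟨?_, fun U hU => (hd _).2 U ?_⟩
    · have h1 : insert e B ∪ S \ {e} = B ∪ S := by
        ext x
        by_cases hx : x = e
        · simp [hx, h]
        · simp [hx]
      rw [← h1]
      exact (hd _).1
    · rintro ⟨h1, h2, h3⟩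
      refine hU ⟨?_, ?_, h3⟩
      · rw [Finset.coe_insert]
        exact Set.sdiff_singleton_subset_iff.1 h1
      · rw [← Set.ncard_sdiff_singleton_add_one h
          ((L.finite_toSet.subset h1).of_sdiff (Set.finite_singleton e))]
        push_cast
        omega
  · rw [glue_of_notMem _ _ h]
    refine ⟨(hc _).1, fun U hU => (hc _).2 U ?_⟩
    rintro ⟨h1, h2⟩
    refine hU ⟨h1.trans ?_, h2⟩
    simp

theorem exists_eq_glue [DecidableEq β] {B : Set β} {L : Finset β} {e : β} {i j : ℤ}
    {c : Set β → Finset G.vertexSet → ℝ}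
    (hc : c ∈ G.dualChainGroup r B (insert e L) (i + 1) j) :
    ∃ c₁ ∈ G.dualChainGroup r B L (i + 1) j, ∃ c₂ ∈ G.dualChainGroup r (insert e B) L i j,
      c = glue e c₁ c₂ := by
  classical
  refine ⟨fun S => if e ∈ S then 0 else c S, fun S => ?_,
    fun S => if e ∈ S then 0 else c (insert e S), fun S => ?_, ?_⟩
  · by_cases h : e ∈ S
    · simp only [if_pos h]
      exact ⟨zero_mem _, fun U _ => rfl⟩
    · simp only [if_neg h]
      refine ⟨(hc S).1, fun U hU => (hc S).2 U ?_⟩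
      rintro ⟨h1, h2⟩
      rw [Finset.coe_insert, Set.subset_insert_iff_of_notMem h] at h1
      exact hU ⟨h1, h2⟩
  · by_cases h : e ∈ S
    · simp only [if_pos h]
      exact ⟨zero_mem _, fun U _ => rfl⟩
    · simp only [if_neg h]
      refine ⟨?_, fun U hU => (hc _).2 U ?_⟩
      · rw [Set.insert_union, ← Set.union_insert]
        exact (hc _).1
      · rintro ⟨h1, h2, h3⟩
        rw [Finset.coe_insert, Set.insert_subset_insert_iff h] at h1
        rw [Set.ncard_insert_of_notMem h (L.finite_toSet.subset h1)] at h2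
        push_cast at h2
        exact hU ⟨h1, by omega, h3⟩
  · ext1 S
    by_cases h : e ∈ S
    · simp [glue_of_mem _ _ h, Set.insert_eq_of_mem h]
    · simp [glue_of_notMem _ _ h, h]

/-- This is the differential of a mapping cone. As `e` is smaller than all elements of `L`, adding
it to a state has sign `+1`, and its presence changes every other sign. -/
theorem dualBoundary_glue [LinearOrder β] {M : Type*} [AddCommGroup M] [Module ℝ M]
    {L : Finset β} {e : β} (he : ∀ f ∈ L, e < f) (c : Set β → M) {d : Set β → M}
    (hd : ∀ S : Set β, ¬ S ⊆ L → d S = 0) :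
    dualBoundary (insert e L) (glue e c d) =
      glue e (dualBoundary L c + d) (-dualBoundary L d) := by
  classical
  have heL : e ∉ L := fun h => lt_irrefl _ (he e h)
  ext1 S
  rw [dualBoundary_apply, Finset.filter_insert]
  by_cases h : e ∈ S
  · obtain ⟨T, hT⟩ : ∃ T, T = S \ {e} := ⟨_, rfl⟩
    rw [glue_of_mem _ _ h, ← hT, if_neg (not_not.2 h), Pi.neg_apply, dualBoundary_apply,
      ← Finset.sum_neg_distrib]
    refine Finset.sum_congr ?_ fun f hf => ?_
    · refine Finset.filter_congr fun f hf => ?_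
      have : f ≠ e := fun h => heL (h ▸ hf)
      simp [hT, this]
    · rw [Finset.mem_filter] at hf
      have hfe : f ≠ e := fun h => heL (h ▸ hf.1)
      have h1 : insert f S \ {e} = insert f T := by
        rw [hT, Set.insert_sdiff_of_notMem]
        simpa using hfe
      rw [glue_of_mem _ _ (Set.mem_insert_of_mem _ h), h1]
      by_cases hS : insert f T ⊆ (L : Set β)
      · have hfin : T.Finite := L.finite_toSet.subset ((Set.subset_insert _ _).trans hS)
        have h2 : {g ∈ S | g < f} = insert e {g ∈ T | g < f} := by
          ext g
          by_cases hg : g = e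
          · simp [hg, h, he f hf.1]
          · simp [hT, hg]
        rw [h2, Set.ncard_insert_of_notMem (by simp [hT]) (hfin.subset (Set.sep_subset _ _)),
          pow_succ, mul_neg_one, neg_smul]
      · rw [hd _ hS, smul_zero, smul_zero, neg_zero]
  · rw [glue_of_notMem _ _ h, if_pos h, Finset.sum_insert (by simp [heL]), Pi.add_apply,
      add_comm, dualBoundary_apply]
    congr 1
    · refine Finset.sum_congr rfl fun f hf => ?_
      rw [Finset.mem_filter] at hf
      have hfe : e ≠ f := fun h => heL (h ▸ hf.1)
      rw [glue_of_notMem c d (by simp [hfe, h])]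
    · rw [glue_of_mem _ _ (Set.mem_insert _ _), Set.insert_sdiff_self_of_notMem h]
      by_cases hS : S ⊆ (L : Set β)
      · have h2 : {g ∈ S | g < e} = ∅ := by
          ext g
          simpa using fun hg => (he g (hS hg)).le
        rw [h2, Set.ncard_empty, pow_zero, one_smul]
      · rw [hd _ hS, smul_zero]

theorem eq_zero_of_glue_eq_zero {M : Type*} [Zero M] {L : Finset β} {e : β} (he : e ∉ L)
    {c d : Set β → M} (hc : ∀ S : Set β, ¬ S ⊆ L → c S = 0)
    (hd : ∀ S : Set β, ¬ S ⊆ L → d S = 0) (h : glue e c d = 0) : c = 0 ∧ d = 0 := by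
  constructor
  · ext1 S
    by_cases hS : e ∈ S
    · exact hc S fun h => he (h hS)
    · rw [← glue_of_notMem c d hS, h]
  · ext1 S
    by_cases hS : e ∈ S
    · exact hd S fun h => he (h hS)
    · have := congrFun h (insert e S)
      rwa [glue_of_mem _ _ (Set.mem_insert _ _), Set.insert_sdiff_self_of_notMem hS] at this

end Glue

/-! ### Exactness of the dual complex off the diagonal. -/

section Exactness

variable {α β : Type*} {G : Graph α β} {r : G.vertexSet}

theorem dualChainGroup_anti {B B' : Set β} (h : B ⊆ B') (L : Finset β) (i j : ℤ) :
    G.dualChainGroup r B' L i j ≤ G.dualChainGroup r B L i j :=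
  fun _ hc S => ⟨dualSummand_anti (Set.union_subset_union_left _ h) (hc S).1, (hc S).2⟩

variable [LinearOrder β]

/-- In the cone, the square of the boundary sends `(c, d)` to `(DDc + Dd - Dd, DDd)`, which vanishes
by induction. -/
theorem dualBoundary_dualBoundary (L : Finset β) :
    ∀ (B : Set β) (i j : ℤ), ∀ c ∈ G.dualChainGroup r B L i j,
      dualBoundary L (dualBoundary L c) = 0 := by
  induction L using Finset.induction_on_min with
  | empty =>
    intro B i j c _
    ext1 S
    simp [dualBoundary_apply]
  | insert e L he ih =>
    intro B i j c hc
    obtain ⟨i, rfl⟩ : ∃ i', i = i' + 1 := ⟨i - 1, by ring⟩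
    obtain ⟨c₁, hc₁, c₂, hc₂, rfl⟩ := exists_eq_glue hc
    obtain ⟨k, rfl⟩ : ∃ k, i = k + 1 := ⟨i - 1, by ring⟩
    rw [dualBoundary_glue he _ fun S => eq_zero_of_mem_dualChainGroup hc₂,
      dualBoundary_glue he _ fun S => eq_zero_of_mem_dualChainGroup (neg_mem (dualBoundary_mem hc₂)),
      map_add, map_neg, ih _ _ _ _ hc₁, ih _ _ _ _ hc₂]
    ext1 S
    simp [glue]

open scoped Classical in
/-- The case of a bridge in `exists_dualBoundary_eq`. -/
theorem exists_dualBoundary_eq_of_bridge {B : Set β} {L : Finset β} {e : β} {i j : ℤ}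
    {a b : G.vertexSet} (hl : G.IsLink e a b)
    (hab : G.component (B ∪ L) a ≠ G.component (B ∪ L) b)
    (ih : ∀ c ∈ G.dualChainGroup r (insert e B) L (i + 1) (j - 1), dualBoundary L c = 0 →
      ∃ g ∈ G.dualChainGroup r (insert e B) L (i + 1 + 1) (j - 1), dualBoundary L g = c)
    {c d : Set β → Finset G.vertexSet → ℝ} (hc : c ∈ G.dualChainGroup r B L (i + 1) j)
    (hd : d ∈ G.dualChainGroup r (insert e B) L i j) (hcd : dualBoundary L c + d = 0) :
    ∃ g ∈ G.dualChainGroup r B L (i + 1 + 1) j,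
      c - dualBoundary L g ∈ G.dualChainGroup r (insert e B) L (i + 1) j := by
  set δ : (Finset G.vertexSet → ℝ) →ₗ[ℝ] (Finset G.vertexSet → ℝ) :=
    contraction a - contraction b with hδ
  have hδ' : ∀ f, δ f = contraction a f - contraction b f := fun f => rfl
  -- The side of the bridge that contains `b`. Changing the signs of its variables respects the
  -- relations from `B ∪ L` and exchanges the kernels of the sum and the difference of the
  -- contractions with `a` and `b`.
  set K : Set G.vertexSet := {v | G.component (B ∪ L) v = G.component (B ∪ L) b} with hK
  have haK : a ∉ K := hab
  have hbK : b ∈ K := rfl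
  have hBS : ∀ S : Set β, insert e B ∪ S = insert e (B ∪ S) := fun S => Set.insert_union
  have hδd : ∀ S, δ (d S) = 0 := by
    intro S
    rw [hδ', sub_eq_zero]
    exact (hd S).1.2 e (Or.inl (Set.mem_insert _ _)) a b hl
  -- The values of `δ` are killed by the sum of the two contractions, because the squares vanish;
  -- after the change of signs they satisfy the relation of `e`. One contraction lowers the degree
  -- by one.
  have hc₃ : (fun S => signFlip K (δ (c S))) ∈
      G.dualChainGroup r (insert e B) L (i + 1) (j - 1) := by
    intro S
    change signFlip K (δ (c S)) ∈ _ ∧ ∀ U, _ → signFlip K (δ (c S)) U = 0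
    constructor
    · by_cases hS : S ⊆ (L : Set β)
      · rw [hBS, mem_dualSummand_insert hl]
        refine ⟨signFlip_mem_dualSummand (Set.union_subset_union_right _ hS) _ ?_, ?_⟩
        · exact sub_mem (contraction_mem_dualSummand (hc S).1 a)
            (contraction_mem_dualSummand (hc S).1 b)
        · rw [contraction_signFlip_of_notMem haK, contraction_signFlip_of_mem hbK, ← map_neg]
          refine congrArg (signFlip K) ?_
          rw [hδ', map_sub, map_sub, contraction_contraction_self, contraction_contraction_self,
            contraction_comm b a, zero_sub, sub_zero]
      · rw [eq_zero_of_mem_dualChainGroup hc hS, map_zero, map_zero]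
        exact zero_mem _
    · intro U hU
      have key : ∀ v : G.vertexSet, contraction v (c S) U = 0 := by
        intro v
        rw [contraction_apply]
        split_ifs with hv
        · rfl
        · refine (hc S).2 _ ?_
          rintro ⟨h1, h2, h3⟩
          refine hU ⟨h1, h2, ?_⟩
          rw [Finset.card_insert_of_notMem hv] at h3
          push_cast at h3
          omega
      rw [signFlip_apply, hδ', Pi.sub_apply, key, key, sub_zero, mul_zero]
  obtain ⟨h, hh, hhc⟩ := ih _ hc₃ (by
    have := dualBoundary_comp (signFlip K ∘ₗ δ) L c
    rw [eq_neg_of_add_eq_zero_left hcd] at this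
    refine this.trans (funext fun S => ?_)
    rw [LinearMap.comp_apply, Pi.neg_apply, map_neg, hδd, neg_zero, map_zero]
    rfl)
  -- `h` is lifted through `δ` for each `S` separately; the lift need not be compatible with the
  -- boundary. Outside the bidegree it is taken to be zero.
  have hg : ∀ S : Set β, ∃ g ∈ G.dualSummand r (B ∪ S),
      (∀ U, ¬ (S ⊆ L ∧ S.ncard = i + 1 + 1 ∧ U.card = j) → g U = 0) ∧
        δ g = signFlip K (h S) := by
    intro S
    by_cases hS : S ⊆ (L : Set β) ∧ S.ncard = i + 1 + 1
    · have hBSL : B ∪ S ⊆ B ∪ L := Set.union_subset_union_right _ hS.1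
      have h1 := (hh S).1
      rw [hBS, mem_dualSummand_insert hl] at h1
      obtain ⟨g, hg, hgj, hgδ⟩ := exists_contraction_sub_eq (j := j - 1)
        (f := signFlip K (h S)) (a := a) (b := b)
        (signFlip_mem_dualSummand hBSL b h1.1) (fun U hU => by
          rw [signFlip_apply, (hh S).2 U fun h => hU h.2.2, mul_zero])
        (fun h => hab (G.component_eq_mono hBSL h)) (by
          rw [contraction_signFlip_of_notMem haK, contraction_signFlip_of_mem hbK, h1.2,
            add_neg_cancel])
      refine ⟨g, hg, fun U hU => hgj U fun h => hU ⟨hS.1, hS.2, ?_⟩, hgδ⟩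
      rw [h, sub_add_cancel]
    · refine ⟨0, zero_mem _, fun U _ => rfl, ?_⟩
      have : h S = 0 := funext fun U => (hh S).2 U fun h => hS ⟨h.1, h.2.1⟩
      rw [this, map_zero, map_zero]
  choose g hg hgz hgδ using hg
  have hgC : g ∈ G.dualChainGroup r B L (i + 1 + 1) j := fun S => ⟨hg S, hgz S⟩
  have hsub := sub_mem hc (dualBoundary_mem hgC)
  refine ⟨g, hgC, fun S => ⟨?_, (hsub S).2⟩⟩
  rw [hBS, mem_dualSummand_insert hl]
  refine ⟨(hsub S).1, ?_⟩
  -- The relation of `e` says that `δ` vanishes. Since `δ` commutes with the boundary, `δ` of the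
  -- boundary of `g` is the flipped boundary of `h`, that is, `δ (c S)`.
  rw [← sub_eq_zero, ← hδ', Pi.sub_apply, map_sub, sub_eq_zero]
  have h1 : δ (dualBoundary L g S) = dualBoundary L (fun S => δ (g S)) S := by
    rw [dualBoundary_comp]
  have h2 : (fun S => δ (g S)) = fun S => signFlip K (h S) := funext hgδ
  rw [h1, h2, dualBoundary_comp, hhc]
  exact (signFlip_signFlip _ _).symm

/-- The dual complex of a connected graph is exact outside a diagonal. -/
theorem exists_dualBoundary_eq (hV : G.vertexSet.Finite) (L : Finset β) :
    (L : Set β) ⊆ G.edgeSet → ∀ (B : Set β) (i j : ℤ),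
      (∀ v w, G.component (B ∪ L) v = G.component (B ∪ L) w) →
      i + j ≠ Nat.card (G.Component B) - 1 →
      ∀ c ∈ G.dualChainGroup r B L i j, dualBoundary L c = 0 →
      ∃ g ∈ G.dualChainGroup r B L (i + 1) j, dualBoundary L g = c := by
  classical
  induction L using Finset.induction_on_min with
  | empty =>
    intro _ B i j hconn hij c hc _
    refine ⟨0, zero_mem _, ?_⟩
    rw [map_zero]
    rw [Finset.coe_empty, Set.union_empty] at hconn
    rw [card_component_eq_one r hconn] at hij
    symm
    ext S U
    -- With a single component every variable equals the base variable, so only `U = ∅` survives. It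
    -- has `i = j = 0`, which is the excluded diagonal.
    by_cases h : S ⊆ ((∅ : Finset β) : Set β) ∧ S.ncard = i ∧ U.card = j
    · obtain ⟨h1, h2, h3⟩ := h
      have hS : S = ∅ := by simpa using h1
      obtain ⟨u, hu⟩ : U.Nonempty := by
        rw [← Finset.card_pos]
        rw [hS, Set.ncard_empty] at h2
        push_cast at h2 hij
        omega
      rw [apply_eq_contraction hu (c S), contraction_eq_zero_of_component_eq (hc S).1]
      · rfl
      · exact G.component_eq_mono Set.subset_union_left (hconn u r)
    · exact (hc S).2 U h
  | insert e L he ih =>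
    intro hL B i j hconn hij c hc hDc
    have heL : e ∉ L := fun h => lt_irrefl _ (he e h)
    rw [Finset.coe_insert] at hL hconn
    have heE : e ∈ G.edgeSet := hL (Set.mem_insert _ _)
    replace ih := ih ((Set.subset_insert _ _).trans hL)
    have hconn' : ∀ v w, G.component (insert e B ∪ L) v = G.component (insert e B ∪ L) w := by
      rw [Set.insert_union, ← Set.union_insert]
      exact hconn
    obtain ⟨i, rfl⟩ : ∃ i', i = i' + 1 := ⟨i - 1, by ring⟩
    obtain ⟨c₁, hc₁, c₂, hc₂, rfl⟩ := exists_eq_glue hc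
    have hc₂z : ∀ S : Set β, ¬ S ⊆ L → c₂ S = 0 := fun S => eq_zero_of_mem_dualChainGroup hc₂
    have hDc₂m : dualBoundary L c₂ ∈ G.dualChainGroup r (insert e B) L (i - 1) j :=
      dualBoundary_mem (by rwa [sub_add_cancel])
    rw [dualBoundary_glue he _ hc₂z] at hDc
    obtain ⟨h1, h2⟩ := eq_zero_of_glue_eq_zero heL
      (fun S => eq_zero_of_mem_dualChainGroup (add_mem (dualBoundary_mem hc₁)
        (dualChainGroup_anti (Set.subset_insert _ _) _ _ _ hc₂)))
      (fun S => eq_zero_of_mem_dualChainGroup (neg_mem hDc₂m)) hDc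
    rw [neg_eq_zero] at h2
    have h3 : c₂ = -dualBoundary L c₁ := (neg_eq_of_add_eq_zero_right h1).symm
    -- Here `e` is a loop after contracting `B`: deletion and contraction have the same summands,
    -- and `c₁` itself, placed in the contraction, bounds the cycle.
    by_cases hspan : G.Spans B e
    · have hc₁' : c₁ ∈ G.dualChainGroup r (insert e B) L (i + 1) j := by
        intro S
        refine ⟨?_, (hc₁ S).2⟩
        rw [Set.insert_union]
        exact mem_dualSummand_insert_of_spans (hspan.mono Set.subset_union_left) (hc₁ S).1
      refine ⟨glue e 0 c₁, glue_mem_dualChainGroup (zero_mem _) hc₁', ?_⟩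
      rw [dualBoundary_glue he _ fun S => eq_zero_of_mem_dualChainGroup hc₁, map_zero, zero_add,
        ← h3]
    have hcard := card_component_insert_of_not_spans hV heE hspan
    by_cases hbridge : G.Spans (B ∪ L) e
    -- Neither loop nor bridge: bound `c₂` in the contraction, then bound the corrected cycle `c₁ +
    -- h` in the deletion, which is still connected.
    · obtain ⟨h, hh, hhc⟩ := ih (insert e B) i j hconn' (by omega) c₂ hc₂ h2
      have hh' := dualChainGroup_anti (Set.subset_insert _ _) _ _ _ hh
      obtain ⟨g, hg, hgc⟩ := ih B (i + 1) j (fun v w => by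
          rw [← component_insert_eq_iff_of_spans hbridge, ← Set.union_insert]
          exact hconn v w) hij (c₁ + h) (add_mem hc₁ hh') (by rw [map_add, hhc, h1])
      refine ⟨glue e g (-h), glue_mem_dualChainGroup hg (neg_mem hh), ?_⟩
      rw [dualBoundary_glue he _ fun S => eq_zero_of_mem_dualChainGroup (neg_mem hh), map_neg,
        hgc, hhc, neg_neg, add_neg_cancel_right]
    -- A bridge: only the contraction is used, in bidegree `(i + 1, j - 1)`. Contracting drops both
    -- the coordinate sum and the number of components by one, so the diagonal is still avoided.
    · obtain ⟨x₀, y₀, hl₀⟩ := G.exists_isLink_of_mem_edgeSet heE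
      obtain ⟨x, y, hl⟩ : ∃ x y : G.vertexSet, G.IsLink e x y :=
        ⟨⟨x₀, hl₀.left_mem⟩, ⟨y₀, hl₀.right_mem⟩, hl₀⟩
      obtain ⟨g, hg, hgc⟩ := exists_dualBoundary_eq_of_bridge hl
        (fun h => hbridge ⟨x, y, hl, h⟩)
        (ih (insert e B) (i + 1) (j - 1) hconn' (by omega)) hc₁ hc₂ h1
      refine ⟨glue e g (c₁ - dualBoundary L g), glue_mem_dualChainGroup hg hgc, ?_⟩
      rw [dualBoundary_glue he _ fun S => eq_zero_of_mem_dualChainGroup hgc, map_sub,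
        dualBoundary_dualBoundary L B _ _ g hg, sub_zero, ← h3, add_sub_cancel]

end Exactness

/-! ### States as monomials: choosing a vertex in each `x`-component. -/

section Transversals

variable {α β : Type*} {G : Graph α β} {r : G.vertexSet}

/-- Together with the base point, the elements of `U` lie in different components of the spanning
subgraph with edge set `S`. -/
def IsReducedTransversal (G : Graph α β) (r : G.vertexSet) (S : Set β)
    (U : Finset G.vertexSet) : Prop :=
  r ∉ U ∧ Set.InjOn (G.component S) (insert r (U : Set G.vertexSet))

theorem apply_eq_zero_of_component_eq {S : Set β} {f : Finset G.vertexSet → ℝ}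
    (hf : f ∈ G.dualSummand r S) {U : Finset G.vertexSet} {u v : G.vertexSet}
    (hu : u ∈ insert r (U : Set G.vertexSet)) (hv : v ∈ insert r (U : Set G.vertexSet))
    (huv : u ≠ v) (h : G.component S u = G.component S v) : f U = 0 := by
  classical
  have key : ∀ w ∈ U, G.component S w = G.component S r → f U = 0 := by
    intro w hw hwr
    rw [apply_eq_contraction hw f, contraction_eq_zero_of_component_eq hf hwr]
    rfl
  rcases hu with rfl | hu
  · rcases hv with rfl | hv
    · exact absurd rfl huv
    · exact key v hv h.symm
  · rcases hv with rfl | hv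
    · exact key u hu h
    · exact apply_eq_zero_of_contraction_eq huv (contraction_eq_of_component_eq hf h) hu hv

theorem apply_eq_zero_of_not_isReducedTransversal {S : Set β} {f : Finset G.vertexSet → ℝ}
    (hf : f ∈ G.dualSummand r S) {U : Finset G.vertexSet}
    (hU : ¬ G.IsReducedTransversal r S U) : f U = 0 := by
  classical
  by_cases hr : r ∈ U
  · rw [apply_eq_contraction hr f, hf.1]
    rfl
  · have : ¬ Set.InjOn (G.component S) (insert r (U : Set G.vertexSet)) := fun h => hU ⟨hr, h⟩
    rw [Set.InjOn] at this
    push Not at this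
    obtain ⟨u, hu, v, hv, h, huv⟩ := this
    exact apply_eq_zero_of_component_eq hf hu hv huv h

/-- Representatives are exchanged one at a time: contractions with two vertices of the same
component agree on `f`, and contracting stays in the dual summand. -/
theorem apply_eq_of_image_component_eq {S : Set β} (U : Finset G.vertexSet) :
    ∀ (U' : Finset G.vertexSet) (f : Finset G.vertexSet → ℝ), f ∈ G.dualSummand r S →
      Set.InjOn (G.component S) (U : Set G.vertexSet) →
      Set.InjOn (G.component S) (U' : Set G.vertexSet) →
      G.component S '' U = G.component S '' U' → f U = f U' := by
  classical
  induction U using Finset.induction_on with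
  | empty =>
    intro U' f _ _ _ h
    have : U' = ∅ := by simpa [eq_comm (a := (∅ : Set G.vertexSet))] using h
    rw [this]
  | insert u W hu ih =>
    intro U' f hf hinj hinj' h
    obtain ⟨u', hu', huu'⟩ : G.component S u ∈ G.component S '' U' := by
      rw [← h]
      exact ⟨u, by simp, rfl⟩
    rw [apply_eq_contraction (Finset.mem_insert_self u W) f, apply_eq_contraction hu' f,
      contraction_eq_of_component_eq hf huu', Finset.erase_insert hu]
    have hW : (W : Set G.vertexSet) = ↑(insert u W) \ {u} := by
      ext x
      by_cases hx : x = u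
      · simp [hx, hu]
      · simp [hx]
    refine ih _ _ (contraction_mem_dualSummand hf u) (hinj.mono (by simp))
      (hinj'.mono (Finset.erase_subset _ _)) ?_
    rw [hW, hinj.image_sdiff_subset (by simp), Finset.coe_erase,
      hinj'.image_sdiff_subset (by simpa using hu'), h, Set.image_singleton, Set.image_singleton,
      huu']

namespace ReducedEnhancedState

/-- `U` contains one vertex of every component coloured `x` apart from that of the base point. -/
def IsTransversal (s : G.ReducedEnhancedState r) (U : Finset G.vertexSet) : Prop :=
  G.IsReducedTransversal r s.edges U ∧
    G.component s.edges '' insert r (U : Set G.vertexSet) = s.xComponents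

theorem IsTransversal.degree_eq {s : G.ReducedEnhancedState r} {U : Finset G.vertexSet}
    (h : s.IsTransversal U) : s.degree = U.card := by
  rw [degree, ← h.2, h.1.2.ncard_image,
    Set.ncard_insert_of_notMem (by simpa using h.1.1) (Finset.finite_toSet U), Set.ncard_coe_finset]
  push_cast
  ring

theorem IsTransversal.apply_eq {s : G.ReducedEnhancedState r} {U U' : Finset G.vertexSet}
    (h : s.IsTransversal U) (h' : s.IsTransversal U') {f : Finset G.vertexSet → ℝ}
    (hf : f ∈ G.dualSummand r s.edges) : f U = f U' := by
  have key : ∀ W : Finset G.vertexSet, s.IsTransversal W →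
      G.component s.edges '' W = s.xComponents \ {G.component s.edges r} := by
    intro W hW
    have h1 : (W : Set G.vertexSet) = insert r (W : Set G.vertexSet) \ {r} := by
      rw [Set.insert_sdiff_self_of_notMem (by simpa using hW.1.1)]
    rw [h1, hW.1.2.image_sdiff_subset (by simp), hW.2, Set.image_singleton]
  exact apply_eq_of_image_component_eq U U' f hf (h.1.2.mono (Set.subset_insert _ _))
    (h'.1.2.mono (Set.subset_insert _ _)) ((key U h).trans (key U' h').symm)

theorem exists_isTransversal [Finite G.vertexSet] (s : G.ReducedEnhancedState r) :
    ∃ U, s.IsTransversal U := by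
  classical
  set κ := G.component s.edges with hκ
  obtain ⟨σ, hσ⟩ := (component_surjective (G := G) s.edges).hasRightInverse
  have hfin : (σ '' (s.xComponents \ {κ r})).Finite := Set.toFinite _
  have hmem : ∀ u ∈ σ '' (s.xComponents \ {κ r}), σ (κ u) = u ∧ κ u ≠ κ r := by
    rintro _ ⟨c, hc, rfl⟩
    have h1 : κ (σ c) = c := hσ c
    rw [h1]
    exact ⟨rfl, hc.2⟩
  refine ⟨hfin.toFinset, ⟨fun hr => ?_, ?_⟩, ?_⟩
  · rw [Set.Finite.mem_toFinset] at hr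
    exact (hmem r hr).2 rfl
  · rw [Set.Finite.coe_toFinset]
    rintro u (rfl | hu) v (rfl | hv) huv
    · rfl
    · exact absurd huv.symm (hmem v hv).2
    · exact absurd huv (hmem u hu).2
    · rw [← (hmem u hu).1, ← (hmem v hv).1]
      exact congrArg σ huv
  · rw [Set.Finite.coe_toFinset, Set.image_insert_eq, ← Set.image_comp]
    have : κ ∘ σ = id := funext hσ
    rw [this, Set.image_id, Set.insert_sdiff_singleton, Set.insert_eq_of_mem s.base_mem]

/-- The state with given edges in which the components of the base point and of the elements of
`U` are coloured `x`. -/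
def ofFinset (r : G.vertexSet) {S : Set β} (hS : S ⊆ G.edgeSet) (U : Finset G.vertexSet) :
    G.ReducedEnhancedState r where
  edges := S
  edges_subset := hS
  xComponents := G.component S '' insert r (U : Set G.vertexSet)
  base_mem := ⟨r, Set.mem_insert _ _, rfl⟩

theorem isTransversal_ofFinset {S : Set β} (hS : S ⊆ G.edgeSet) {U : Finset G.vertexSet}
    (hU : G.IsReducedTransversal r S U) : (ofFinset r hS U).IsTransversal U :=
  ⟨hU, rfl⟩

theorem IsTransversal.ofFinset_eq {s : G.ReducedEnhancedState r} {U : Finset G.vertexSet}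
    (h : s.IsTransversal U) : ofFinset r s.edges_subset U = s := by
  obtain ⟨S, hS, X, hX⟩ := s
  have h' : G.component S '' insert r (U : Set G.vertexSet) = X := h.2
  subst h'
  rfl

/-- The same monomial describes the state before and after adding the edge. This is why the
differential dualizes to inclusions. -/
theorem IsTransversal.addEdge {s : G.ReducedEnhancedState r} {U : Finset G.vertexSet}
    (h : s.IsTransversal U) {e : β} (he : e ∈ G.edgeSet) (hs : ¬ s.JoinsXX e) :
    (s.addEdge e he).IsTransversal U := by
  classical
  refine ⟨⟨h.1.1, ?_⟩, ?_⟩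
  · intro u hu v hv huv
    refine h.1.2 hu hv ?_
    by_contra hne
    have hu' : G.component s.edges u ∈ s.xComponents := h.2 ▸ ⟨u, hu, rfl⟩
    have hv' : G.component s.edges v ∈ s.xComponents := h.2 ▸ ⟨v, hv, rfl⟩
    obtain ⟨x₀, y₀, hl₀⟩ := G.exists_isLink_of_mem_edgeSet he
    obtain ⟨x, y, hl⟩ : ∃ x y : G.vertexSet, G.IsLink e x y :=
      ⟨⟨x₀, hl₀.left_mem⟩, ⟨y₀, hl₀.right_mem⟩, hl₀⟩
    have h1 := (component_insert_eq_iff hl).1 huv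
    split_ifs at h1 with h2 h3 h3
    · exact hne (h2.trans h3.symm)
    · exact hs ⟨y, x, hl.symm, by rw [← h2, h1]; exact hne, h2 ▸ hu', h1 ▸ hv'⟩
    · exact hs ⟨x, y, hl, by rw [← h3, ← h1]; exact hne, h1 ▸ hu', h3 ▸ hv'⟩
    · exact hne h1
  · change _ = G.componentMap _ '' s.xComponents
    rw [← h.2, ← Set.image_comp]
    rfl

/-- The dual form of `x * x = 0`: after adding `e`, two of the points of `insert r U` lie in the
same component. -/
theorem JoinsXX.apply_eq_zero {s : G.ReducedEnhancedState r} {e : β} (hs : s.JoinsXX e)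
    {U : Finset G.vertexSet} (h : s.IsTransversal U) {f : Finset G.vertexSet → ℝ}
    (hf : f ∈ G.dualSummand r (insert e s.edges)) : f U = 0 := by
  obtain ⟨v, w, hl, hne, hv, hw⟩ := hs
  rw [← h.2] at hv hw
  obtain ⟨v', hv', hvv'⟩ := hv
  obtain ⟨w', hw', hww'⟩ := hw
  refine apply_eq_zero_of_component_eq hf hv' hw' ?_ ?_
  · rintro rfl
    exact hne (hvv'.symm.trans hww')
  · have hS := Set.subset_insert e s.edges
    exact (G.component_eq_mono hS hvv').trans ((G.component_eq_of_isLink (Set.mem_insert _ _)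
      hl).trans (G.component_eq_mono hS hww').symm)

theorem dimension_addEdge {s : G.ReducedEnhancedState r} (hE : G.edgeSet.Finite) {e : β}
    (he : e ∈ G.edgeSet) (hes : e ∉ s.edges) :
    (s.addEdge e he).dimension = s.dimension + 1 := by
  rw [dimension, dimension]
  change ((insert e s.edges).ncard : ℤ) = _
  rw [Set.ncard_insert_of_notMem hes (hE.subset s.edges_subset)]
  push_cast
  ring

theorem degree_addEdge [Finite G.vertexSet] {s : G.ReducedEnhancedState r} {e : β}
    (he : e ∈ G.edgeSet) (hs : ¬ s.JoinsXX e) : (s.addEdge e he).degree = s.degree := by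
  obtain ⟨U, hU⟩ := s.exists_isTransversal
  rw [hU.degree_eq, (hU.addEdge he hs).degree_eq]

end ReducedEnhancedState

end Transversals

/-! ### The pairing of the dual complex with the cochains. -/

section Duality

variable {α β : Type*} {G : Graph α β} {r : G.vertexSet}

open scoped Classical in
/-- The chain of the dual complex that belongs to a function on the states. -/
noncomputable def dualChain (φ : G.ReducedEnhancedState r → ℝ) (S : Set β)
    (U : Finset G.vertexSet) : ℝ :=
  if h : S ⊆ G.edgeSet ∧ G.IsReducedTransversal r S U then
    φ (ReducedEnhancedState.ofFinset r h.1 U) else 0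

theorem dualChain_edges (φ : G.ReducedEnhancedState r → ℝ) {s : G.ReducedEnhancedState r}
    {U : Finset G.vertexSet} (hU : s.IsTransversal U) : dualChain φ s.edges U = φ s := by
  rw [dualChain, dif_pos ⟨s.edges_subset, hU.1⟩, hU.ofFinset_eq]

open scoped Classical in
theorem IsReducedTransversal.insert_congr {S : Set β} {U : Finset G.vertexSet}
    {x y : G.vertexSet} (h : G.IsReducedTransversal r S (insert x U)) (hx : x ∉ U) (hy : y ∉ U)
    (hxy : G.component S x = G.component S y) : G.IsReducedTransversal r S (insert y U) := by
  rcases eq_or_ne x y with rfl | hne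
  · exact h
  obtain ⟨hr, hinj⟩ := h
  have hyr : y ≠ r := by
    rintro rfl
    exact hne (hinj (by simp) (by simp) hxy)
  rw [Finset.mem_insert, not_or] at hr
  rw [Finset.coe_insert, Set.insert_comm,
    Set.injOn_insert (by simp [hx, Ne.symm hr.1])] at hinj
  refine ⟨by simp [hr.2, hyr.symm], ?_⟩
  rw [Finset.coe_insert, Set.insert_comm, Set.injOn_insert (by simp [hy, hyr])]
  exact ⟨hinj.1, hxy ▸ hinj.2⟩

theorem dualChain_mem_dualSummand (φ : G.ReducedEnhancedState r → ℝ) (S : Set β) :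
    dualChain φ S ∈ G.dualSummand r S := by
  classical
  refine ⟨?_, fun e he x y hl => ?_⟩
  · ext U
    rw [contraction_apply]
    split_ifs with h
    · rfl
    · exact dif_neg fun h' => h'.2.1 (Finset.mem_insert_self _ _)
  · have hxy := G.component_eq_of_isLink he hl
    rcases eq_or_ne x y with rfl | hne
    · rfl
    have key : ∀ U : Finset G.vertexSet, x ∈ U → y ∈ U → dualChain φ S U = 0 := fun U hx hy =>
      dif_neg fun h' => hne (h'.2.2 (Or.inr hx) (Or.inr hy) hxy)
    ext U
    rw [contraction_apply, contraction_apply]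
    split_ifs with hx hy hy
    · rfl
    · exact (key _ (Finset.mem_insert_of_mem hx) (Finset.mem_insert_self _ _)).symm
    · exact key _ (Finset.mem_insert_self _ _) (Finset.mem_insert_of_mem hy)
    · by_cases hS : S ⊆ G.edgeSet
      · by_cases hU : G.IsReducedTransversal r S (insert x U)
        · have hT : (ReducedEnhancedState.ofFinset r hS (insert x U)).IsTransversal
              (insert y U) := by
            refine ⟨hU.insert_congr hx hy hxy, ?_⟩
            change G.component S '' _ = G.component S '' _
            rw [Finset.coe_insert, Finset.coe_insert, Set.insert_comm, Set.insert_comm r,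
              Set.image_insert_eq, Set.image_insert_eq (a := x), hxy]
          exact (dif_pos ⟨hS, hU⟩).trans (dualChain_edges φ hT).symm
        · rw [dualChain, dualChain, dif_neg fun h => hU h.2,
            dif_neg fun h => hU (h.2.insert_congr hy hx hxy.symm)]
      · rw [dualChain, dualChain, dif_neg fun h => hS h.1, dif_neg fun h => hS h.1]

theorem dualChain_mem_dualChainGroup (hE : G.edgeSet.Finite) {i j : ℤ}
    {φ : G.ReducedEnhancedState r → ℝ} (hφ : ∀ s, ¬ (s.dimension = i ∧ s.degree = j) → φ s = 0) :
    dualChain φ ∈ G.dualChainGroup r ∅ hE.toFinset i j := by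
  refine fun S => ⟨by simpa using dualChain_mem_dualSummand φ S, fun U hU => ?_⟩
  rw [dualChain]
  split_ifs with h
  · refine hφ _ fun h' => hU ⟨by simpa using h.1, h'.1, ?_⟩
    rw [← h'.2, (ReducedEnhancedState.isTransversal_ofFinset h.1 h.2).degree_eq]
  · rfl

variable [Finite G.vertexSet]

/-- The linear form on the reduced cochains that belongs to a chain of the dual complex. -/
noncomputable def evalChain (c : Set β → Finset G.vertexSet → ℝ) :
    (G.ReducedEnhancedState r →₀ ℝ) →ₗ[ℝ] ℝ :=
  Finsupp.linearCombination ℝ fun s => c s.edges s.exists_isTransversal.choose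

theorem evalChain_single {s : G.ReducedEnhancedState r} {U : Finset G.vertexSet}
    (hU : s.IsTransversal U) {c : Set β → Finset G.vertexSet → ℝ}
    (hc : c s.edges ∈ G.dualSummand r s.edges) (a : ℝ) :
    evalChain c (Finsupp.single s a) = a * c s.edges U := by
  rw [evalChain, Finsupp.linearCombination_single, smul_eq_mul,
    s.exists_isTransversal.choose_spec.apply_eq hU hc]

/-- On a single state, every summand can be evaluated at the same transversal `U`; a summand that
joins two `x`-components contributes zero on both sides. -/
theorem evalChain_reducedDifferential [LinearOrder β] (hE : G.edgeSet.Finite) {i j : ℤ}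
    {c : Set β → Finset G.vertexSet → ℝ} (hc : c ∈ G.dualChainGroup r ∅ hE.toFinset i j)
    (z : G.ReducedEnhancedState r →₀ ℝ) :
    evalChain c (G.reducedDifferential r z) = evalChain (dualBoundary hE.toFinset c) z := by
  classical
  have hcJ : ∀ S, c S ∈ G.dualSummand r S := fun S => by simpa using (hc S).1
  obtain ⟨i, rfl⟩ : ∃ i', i = i' + 1 := ⟨i - 1, by ring⟩
  have hDJ : ∀ S, dualBoundary hE.toFinset c S ∈ G.dualSummand r S := fun S => by
    simpa using (dualBoundary_mem hc S).1
  refine LinearMap.congr_fun (f := evalChain c ∘ₗ G.reducedDifferential r)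
    (Finsupp.lhom_ext fun s a => ?_) z
  obtain ⟨U, hU⟩ := s.exists_isTransversal
  have hfin : Finite {e : β // e ∈ G.edgeSet ∧ e ∉ s.edges} :=
    (hE.subset fun e he => he.1 : {e : β | e ∈ G.edgeSet ∧ e ∉ s.edges}.Finite).to_subtype
  have := Fintype.ofFinite {e : β // e ∈ G.edgeSet ∧ e ∉ s.edges}
  have hsummand : ∀ e (he : e ∈ G.edgeSet), evalChain c (s.differentialSummand e he) =
      (-1 : ℝ) ^ {f ∈ s.edges | f < e}.ncard * c (insert e s.edges) U := by
    intro e he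
    rw [ReducedEnhancedState.differentialSummand]
    split_ifs with hs
    · rw [map_zero, hs.apply_eq_zero hU (hcJ _), mul_zero]
    · exact evalChain_single (hU.addEdge he hs) (hcJ _) _
  rw [LinearMap.comp_apply, reducedDifferential, Finsupp.linearCombination_single, map_smul,
    finsum_eq_sum_of_fintype, map_sum, evalChain_single hU (hDJ _), smul_eq_mul,
    dualBoundary_apply, Finset.sum_apply]
  congr 1
  rw [Finset.sum_subtype (p := fun e => e ∈ G.edgeSet ∧ e ∉ s.edges) _ (by simp)]
  exact Finset.sum_congr rfl fun e _ => hsummand e.1 e.2.1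

theorem evalChain_dualChain (φ : G.ReducedEnhancedState r → ℝ) (s : G.ReducedEnhancedState r)
    (a : ℝ) : evalChain (dualChain φ) (Finsupp.single s a) = a * φ s := by
  obtain ⟨U, hU⟩ := s.exists_isTransversal
  rw [evalChain_single hU (dualChain_mem_dualSummand φ _), dualChain_edges φ hU]

theorem eq_zero_of_evalChain_eq_zero {hE : G.edgeSet.Finite} {i j : ℤ}
    {c : Set β → Finset G.vertexSet → ℝ} (hc : c ∈ G.dualChainGroup r ∅ hE.toFinset i j)
    (h : ∀ s : G.ReducedEnhancedState r, s.dimension = i → s.degree = j →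
      evalChain c (Finsupp.single s 1) = 0) : c = 0 := by
  have hcJ : ∀ S, c S ∈ G.dualSummand r S := fun S => by simpa using (hc S).1
  ext S U
  by_cases hS : S ⊆ hE.toFinset ∧ S.ncard = i ∧ U.card = j
  · by_cases hU : G.IsReducedTransversal r S U
    · have hT := ReducedEnhancedState.isTransversal_ofFinset (by simpa using hS.1) hU
      have := h (ReducedEnhancedState.ofFinset r (by simpa using hS.1) U) hS.2.1
        (hT.degree_eq.trans hS.2.2)
      rwa [evalChain_single hT (hcJ _), one_mul] at this
    · exact apply_eq_zero_of_not_isReducedTransversal (hcJ S) hU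
  · exact (hc S).2 U hS

variable [LinearOrder β]

theorem reducedDifferential_mem (hE : G.edgeSet.Finite) {i j : ℤ}
    {z : G.ReducedEnhancedState r →₀ ℝ} (hz : z ∈ G.reducedCochainGroup r i j) :
    G.reducedDifferential r z ∈ G.reducedCochainGroup r (i + 1) j := by
  rw [reducedDifferential, Finsupp.linearCombination_apply]
  refine sum_mem fun s hs => Submodule.smul_mem _ _ ?_
  obtain ⟨hi, hj⟩ := hz hs
  refine finsum_induction (· ∈ G.reducedCochainGroup r (i + 1) j) (zero_mem _)
    (fun _ _ => add_mem) fun e => ?_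
  rw [ReducedEnhancedState.differentialSummand]
  split_ifs with h
  · exact zero_mem _
  · refine Finsupp.single_mem_supported _ _ ⟨?_, ?_⟩
    · rw [ReducedEnhancedState.dimension_addEdge hE e.2.1 e.2.2, hi]
    · rw [ReducedEnhancedState.degree_addEdge e.2.1 h, hj]

/-- Each coordinate form is the pairing with a dual chain, so the claim follows by adjunction from
`dualBoundary_dualBoundary`. -/
theorem reducedDifferential_reducedDifferential (hE : G.edgeSet.Finite)
    (z : G.ReducedEnhancedState r →₀ ℝ) :
    G.reducedDifferential r (G.reducedDifferential r z) = 0 := by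
  classical
  ext t
  have ht := dualChain_mem_dualChainGroup hE (i := t.dimension) (j := t.degree)
    (φ := Pi.single t 1) fun s hs => Pi.single_eq_of_ne (by rintro rfl; exact hs ⟨rfl, rfl⟩) _
  have hcoord : ∀ w : G.ReducedEnhancedState r →₀ ℝ,
      evalChain (dualChain (Pi.single t 1)) w = w t := by
    refine LinearMap.congr_fun (g := Finsupp.lapply t) (Finsupp.lhom_ext fun s a => ?_)
    rw [evalChain_dualChain, Finsupp.lapply_apply, Finsupp.single_apply, Pi.single_apply]
    simp [eq_comm]
  rw [← hcoord, evalChain_reducedDifferential hE ht,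
    evalChain_reducedDifferential hE (i := t.dimension - 1) (j := t.degree)
      (dualBoundary_mem (by rwa [sub_add_cancel])), dualBoundary_dualBoundary _ _ _ _ _ ht]
  exact LinearMap.congr_fun (Finsupp.linearCombination_zero _ _ _) z

/-- The reduced chromatic cohomology of a connected graph is concentrated on one diagonal. -/
theorem reducedCocycles_le_reducedCoboundaries (hE : G.edgeSet.Finite) (hG : G.IsConnected)
    {i j : ℤ} (hij : i + j ≠ Nat.card G.vertexSet - 1) :
    G.reducedCocycles r i j ≤ G.reducedCoboundaries r i j := by
  classical
  rintro z ⟨hz, hdz⟩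
  by_contra hzB
  -- A linear form that kills the coboundaries but not `z`. Cut down to bidegree `(i, j)` it is a
  -- dual cycle, hence a boundary, and by adjunction a boundary pairs to zero with the cocycle `z`.
  obtain ⟨ψ, hψz, hψ⟩ := Submodule.exists_le_ker_of_notMem hzB
  set φ : G.ReducedEnhancedState r → ℝ := fun s =>
    if s.dimension = i ∧ s.degree = j then ψ (Finsupp.single s 1) else 0 with hφ
  have hc := dualChain_mem_dualChainGroup hE (i := i) (j := j) (φ := φ) fun s hs => if_neg hs
  have heval : ∀ w ∈ G.reducedCochainGroup r i j, evalChain (dualChain φ) w = ψ w := by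
    intro w hw
    rw [← Finsupp.sum_single w, Finsupp.sum, map_sum, map_sum]
    refine Finset.sum_congr rfl fun s hs => ?_
    rw [evalChain_dualChain, hφ]
    simp only
    rw [if_pos (show s.dimension = i ∧ s.degree = j from hw hs), ← smul_eq_mul, ← map_smul,
      Finsupp.smul_single, smul_eq_mul, mul_one]
  have hDc : dualBoundary hE.toFinset (dualChain φ) = 0 := by
    refine eq_zero_of_evalChain_eq_zero (i := i - 1) (j := j) (hE := hE)
      (dualBoundary_mem (by rwa [sub_add_cancel])) fun s hi hj => ?_
    have hs : Finsupp.single s 1 ∈ G.reducedCochainGroup r (i - 1) j :=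
      Finsupp.single_mem_supported _ _ ⟨hi, hj⟩
    rw [← evalChain_reducedDifferential hE hc, heval]
    · exact hψ (Submodule.mem_map_of_mem hs)
    · simpa using reducedDifferential_mem hE hs
  obtain ⟨g, hg, hgc⟩ := exists_dualBoundary_eq (Set.toFinite _) hE.toFinset (by simp) ∅ i j
    (by rw [Set.empty_union, hE.coe_toFinset]; exact hG.2) (by rwa [card_component_empty]) _ hc hDc
  refine hψz ?_
  rw [← heval z hz, ← hgc, ← evalChain_reducedDifferential hE hg, hdz, map_zero]

end Duality

end Graph

/-- Two sequences are equal if they agree far out and the sums of successive terms are equal at all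
places but one. -/
theorem eq_of_add_succ_eq {b b' : ℤ → ℕ} {m N k : ℤ} (hm : ∀ i ≤ m, b i = b' i)
    (hN : ∀ i, N ≤ i → b i = b' i) (h : ∀ i, i ≠ k → b i + b (i + 1) = b' i + b' (i + 1)) (i : ℤ) :
    b i = b' i := by
  rcases le_or_gt i k with hik | hik
  · rcases le_total i m with him | him
    · exact hm i him
    · induction i, him using Int.leInduction with
      | base => exact hm m le_rfl
      | succ i _ ih =>
        have := ih (by omega)
        have := h i (by omega)
        omega
  · rcases le_total N i with him | him
    · exact hN i him
    · induction i, him using Int.leInductionDown with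
      | base => exact hN N le_rfl
      | pred i _ ih =>
        have := ih (by omega)
        have := h (i - 1) (by omega)
        rw [sub_add_cancel] at this
        omega

namespace Graph

/-! ### The matroid determines the dimensions of the cochain groups. -/

section Counting

variable {α β α' β' : Type*} {G : Graph α β} {G' : Graph α' β'}

theorem cycleMatroid_indep_iff {I : Set β} : G.cycleMatroid.Indep I ↔ G.IsForest I := by
  exact Iff.rfl

/-- Outside `S`, the edges spanned by `S` are determined by the edge sets of forests. -/
theorem spans_iff_exists_isForest {S : Set β} (hS : S.Finite) (hSE : S ⊆ G.edgeSet) {e : β}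
    (he : e ∈ G.edgeSet) (heS : e ∉ S) :
    G.Spans S e ↔ ∃ I ⊆ S, G.IsForest I ∧ ¬ G.IsForest (insert e I) := by
  constructor
  · intro h
    -- A maximal forest in `S` spans all of `S`, and therefore `e`.
    obtain ⟨I, hI⟩ := (hS.finite_subsets.subset fun I (hI : I ⊆ S ∧ G.IsForest I) =>
      hI.1).exists_maximal ⟨∅, Set.empty_subset _, G.isForest_empty⟩
    have hspan : ∀ f ∈ S, G.Spans I f := by
      intro f hf
      by_contra hn
      have := hI.2 ⟨Set.insert_subset hf hI.1.1, hI.1.2.insert (hSE hf) hn⟩ (Set.subset_insert _ _)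
      exact hn (spans_of_mem (this (Set.mem_insert _ _)) (hSE hf))
    refine ⟨I, hI.1.1, hI.1.2, fun hF => hF.2 e (Set.mem_insert _ _) ?_⟩
    rw [Set.insert_sdiff_self_of_notMem fun h => heS (hI.1.1 h)]
    exact h.trans hspan
  · rintro ⟨I, hIS, hI, hn⟩
    by_contra h
    exact hn (hI.insert he fun h' => h (h'.mono hIS))

theorem spans_image_iff (hE : G.edgeSet.Finite) (hE' : G'.edgeSet.Finite)
    (φ : G.edgeSet ≃ G'.edgeSet)
    (hφ : ∀ I : Set G.edgeSet, G.IsForest (Subtype.val '' I) ↔ G'.IsForest (Subtype.val '' (φ '' I)))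
    {T : Set G.edgeSet} {e : G.edgeSet} (he : e ∉ T) :
    G.Spans (Subtype.val '' T) e ↔ G'.Spans (Subtype.val '' (φ '' T)) (φ e) := by
  have hsub : ∀ T : Set G.edgeSet, Subtype.val '' T ⊆ G.edgeSet := by
    rintro T _ ⟨x, _, rfl⟩
    exact x.2
  have hsub' : ∀ T : Set G'.edgeSet, Subtype.val '' T ⊆ G'.edgeSet := by
    rintro T _ ⟨x, _, rfl⟩
    exact x.2
  rw [spans_iff_exists_isForest (hE.subset (hsub T)) (hsub T) e.2 (by simpa using he),
    spans_iff_exists_isForest (hE'.subset (hsub' _)) (hsub' _) (φ e).2 (by simpa using he)]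
  have hins : ∀ I : Set G.edgeSet, insert (e : β) (Subtype.val '' I) = Subtype.val '' insert e I :=
    fun I => Set.image_insert_eq.symm
  have hins' : ∀ I : Set G.edgeSet, insert (φ e : β') (Subtype.val '' (φ '' I)) =
      Subtype.val '' (φ '' insert e I) := fun I => by
    rw [Set.image_insert_eq, Set.image_insert_eq]
  constructor
  · rintro ⟨I, hIT, hI, hn⟩
    obtain ⟨J, hJT, rfl⟩ := Set.subset_image_iff.1 hIT
    refine ⟨_, Set.image_mono (Set.image_mono hJT), (hφ J).1 hI, ?_⟩
    rwa [hins', ← hφ, ← hins]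
  · rintro ⟨I, hIT, hI, hn⟩
    obtain ⟨J', hJT', rfl⟩ := Set.subset_image_iff.1 hIT
    obtain ⟨J, hJT, rfl⟩ := Set.subset_image_iff.1 hJT'
    refine ⟨_, Set.image_mono hJT, (hφ J).2 hI, ?_⟩
    rwa [hins, hφ, ← hins']

/-- Build `T` edge by edge. An edge lowers the number of components, by one, exactly when it is not
spanned, and this condition is the same in both graphs. The two counts start at the numbers of
vertices. -/
theorem card_component_image_add (hV : G.vertexSet.Finite) (hE : G.edgeSet.Finite)
    (hV' : G'.vertexSet.Finite) (hE' : G'.edgeSet.Finite) (φ : G.edgeSet ≃ G'.edgeSet)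
    (hφ : ∀ I : Set G.edgeSet, G.IsForest (Subtype.val '' I) ↔ G'.IsForest (Subtype.val '' (φ '' I)))
    (T : Set G.edgeSet) :
    Nat.card (G.Component (Subtype.val '' T)) + Nat.card G'.vertexSet =
      Nat.card (G'.Component (Subtype.val '' (φ '' T))) + Nat.card G.vertexSet := by
  have := hE.to_subtype
  induction T, Set.toFinite T using Set.Finite.induction_on with
  | empty =>
    rw [Set.image_empty, Set.image_empty, Set.image_empty, card_component_empty,
      card_component_empty, add_comm]
  | @insert e T he _ ih =>
    rw [Set.image_insert_eq, Set.image_insert_eq, Set.image_insert_eq]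
    by_cases h : G.Spans (Subtype.val '' T) e
    · rw [card_component_insert_of_spans h,
        card_component_insert_of_spans ((spans_image_iff hE hE' φ hφ he).1 h), ih]
    · have h1 := card_component_insert_of_not_spans hV e.2 h
      have h2 := card_component_insert_of_not_spans hV' (φ e).2
        fun h' => h ((spans_image_iff hE hE' φ hφ he).2 h')
      omega

/-- For the set of all edges both graphs have one component. Without connectedness the matroid does
not see the number of vertices. -/
theorem card_vertexSet_eq (hV : G.vertexSet.Finite) (hE : G.edgeSet.Finite)
    (hV' : G'.vertexSet.Finite) (hE' : G'.edgeSet.Finite) (hG : G.IsConnected)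
    (hG' : G'.IsConnected) (φ : G.edgeSet ≃ G'.edgeSet)
    (hφ : ∀ I : Set G.edgeSet,
      G.IsForest (Subtype.val '' I) ↔ G'.IsForest (Subtype.val '' (φ '' I))) :
    Nat.card G.vertexSet = Nat.card G'.vertexSet := by
  have h := card_component_image_add hV hE hV' hE' φ hφ Set.univ
  rw [Set.image_univ, Set.image_univ, φ.range_eq_univ, Set.image_univ, Subtype.range_coe,
    Subtype.range_coe, card_component_eq_one ⟨_, hG.1.some_mem⟩ hG.2,
    card_component_eq_one ⟨_, hG'.1.some_mem⟩ hG'.2] at h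
  omega

/-- Only the number of states matters, so no compatibility with the differentials is asked: for each
edge set any bijection of components will do, corrected by a transposition to match the base
components. -/
theorem exists_injective_state {r : G.vertexSet} {r' : G'.vertexSet} (hV : G.vertexSet.Finite)
    (hV' : G'.vertexSet.Finite) (φ : G.edgeSet ≃ G'.edgeSet)
    (hφ : ∀ T : Set G.edgeSet, Nat.card (G.Component (Subtype.val '' T)) =
      Nat.card (G'.Component (Subtype.val '' (φ '' T)))) :
    ∃ F : G.ReducedEnhancedState r → G'.ReducedEnhancedState r', Function.Injective F ∧
      ∀ s, (F s).dimension = s.dimension ∧ (F s).degree = s.degree := by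
  classical
  set ψ : Set β → Set β' := fun S => Subtype.val '' (φ '' (Subtype.val ⁻¹' S)) with hψ
  have hψE : ∀ S, ψ S ⊆ G'.edgeSet := by
    rintro S _ ⟨x, _, rfl⟩
    exact x.2
  have hε : ∀ S : Set β, S ⊆ G.edgeSet → ∃ ε : G.Component S → G'.Component (ψ S),
      Function.Injective ε ∧ ε (G.component S r) = G'.component (ψ S) r' := by
    intro S hS
    have := finite_component hV S
    have := finite_component hV' (ψ S)
    have hcard : Nat.card (G.Component S) = Nat.card (G'.Component (ψ S)) := by
      rw [hψ, ← hφ, Subtype.image_preimage_coe, Set.inter_eq_right.2 hS]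
    obtain ⟨ε⟩ := Finite.card_eq.1 hcard
    refine ⟨ε.trans (Equiv.swap (ε (G.component S r)) (G'.component (ψ S) r')),
      Equiv.injective _, ?_⟩
    simp
  choose ε hεi hεr using hε
  refine ⟨fun s =>
    { edges := ψ s.edges
      edges_subset := hψE s.edges
      xComponents := ε s.edges s.edges_subset '' s.xComponents
      base_mem := ⟨_, s.base_mem, hεr _ _⟩ }, ?_, fun s => ⟨?_, ?_⟩⟩
  · rintro ⟨S, hS, X, hX⟩ ⟨S', hS', X', hX'⟩ h
    simp only [ReducedEnhancedState.mk.injEq] at h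
    obtain ⟨h1, h2⟩ := h
    have h3 := φ.injective.image_injective (Subtype.val_injective.image_injective h1)
    have hSS' : S = S' := by
      rw [← Set.inter_eq_right.2 hS, ← Set.inter_eq_right.2 hS', ← Subtype.image_preimage_coe,
        ← Subtype.image_preimage_coe]
      exact congrArg _ h3
    subst hSS'
    have hXX' : X = X' := (hεi S hS).image_injective (eq_of_heq h2)
    subst hXX'
    rfl
  · rw [ReducedEnhancedState.dimension, ReducedEnhancedState.dimension]
    change (((ψ s.edges).ncard : ℕ) : ℤ) = _
    rw [hψ, Set.ncard_image_of_injective _ Subtype.val_injective,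
      Set.ncard_image_of_injective _ φ.injective,
      ← Set.ncard_image_of_injective _ (Subtype.val_injective (p := (· ∈ G.edgeSet)))]
    rw [Subtype.image_preimage_coe, Set.inter_eq_right.2 s.edges_subset]
  · rw [ReducedEnhancedState.degree, ReducedEnhancedState.degree]
    change (((ε s.edges s.edges_subset '' s.xComponents).ncard : ℕ) : ℤ) - 1 = _
    rw [Set.ncard_image_of_injective _ (hεi _ _)]

theorem finite_reducedEnhancedState (hV : G.vertexSet.Finite) (hE : G.edgeSet.Finite)
    (r : G.vertexSet) : Finite (G.ReducedEnhancedState r) := by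
  have := hV.to_subtype
  have : Finite {S : Set β // S ⊆ G.edgeSet} := hE.finite_subsets.to_subtype
  refine Finite.of_surjective (fun p : {S : Set β // S ⊆ G.edgeSet} × Finset G.vertexSet =>
    ReducedEnhancedState.ofFinset r p.1.2 p.2) fun s => ?_
  obtain ⟨U, hU⟩ := s.exists_isTransversal
  exact ⟨⟨⟨_, s.edges_subset⟩, U⟩, hU.ofFinset_eq⟩

theorem finrank_reducedCochainGroup (r : G.vertexSet) (i j : ℤ) :
    Module.finrank ℝ (G.reducedCochainGroup r i j) =
      Nat.card {s : G.ReducedEnhancedState r // s.dimension = i ∧ s.degree = j} := by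
  rw [reducedCochainGroup, (Finsupp.supportedEquivFinsupp _).finrank_eq, Module.finrank,
    rank_finsupp_self, Cardinal.toNat_lift]
  rfl

theorem finrank_reducedCochainGroup_le {r : G.vertexSet} {r' : G'.vertexSet}
    (hV : G.vertexSet.Finite) (hV' : G'.vertexSet.Finite) (hE' : G'.edgeSet.Finite)
    (φ : G.edgeSet ≃ G'.edgeSet)
    (hφ : ∀ T : Set G.edgeSet, Nat.card (G.Component (Subtype.val '' T)) =
      Nat.card (G'.Component (Subtype.val '' (φ '' T)))) (i j : ℤ) :
    Module.finrank ℝ (G.reducedCochainGroup r i j) ≤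
      Module.finrank ℝ (G'.reducedCochainGroup r' i j) := by
  have := finite_reducedEnhancedState hV' hE' r'
  obtain ⟨F, hF, hFd⟩ := exists_injective_state (r := r) (r' := r') hV hV' φ hφ
  rw [finrank_reducedCochainGroup, finrank_reducedCochainGroup]
  refine Nat.card_le_card_of_injective
    (Subtype.map F fun s hs => ⟨(hFd s).1.trans hs.1, (hFd s).2.trans hs.2⟩) ?_
  exact Subtype.map_injective _ hF

theorem finrank_reducedCochainGroup_eq {r : G.vertexSet} {r' : G'.vertexSet}
    (hV : G.vertexSet.Finite) (hE : G.edgeSet.Finite) (hV' : G'.vertexSet.Finite)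
    (hE' : G'.edgeSet.Finite) (hG : G.IsConnected)
    (hG' : G'.IsConnected) (φ : G.edgeSet ≃ G'.edgeSet)
    (hφ : ∀ I : Set G.edgeSet, G.IsForest (Subtype.val '' I) ↔ G'.IsForest (Subtype.val '' (φ '' I)))
    (i j : ℤ) :
    Module.finrank ℝ (G.reducedCochainGroup r i j) =
      Module.finrank ℝ (G'.reducedCochainGroup r' i j) := by
  have hcard : ∀ T : Set G.edgeSet, Nat.card (G.Component (Subtype.val '' T)) =
      Nat.card (G'.Component (Subtype.val '' (φ '' T))) := by
    intro T
    have h1 := card_component_image_add hV hE hV' hE' φ hφ T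
    have h2 := card_vertexSet_eq hV hE hV' hE' hG hG' φ hφ
    omega
  refine le_antisymm (finrank_reducedCochainGroup_le hV hV' hE' φ hcard i j)
    (finrank_reducedCochainGroup_le hV' hV hE φ.symm (fun T => ?_) i j)
  rw [hcard, Equiv.image_symm_image]

end Counting

/-! ### Dimensions of cocycles, coboundaries and cohomology. -/

section EulerCharacteristic

variable {α β : Type*} {G : Graph α β} {r : G.vertexSet} [LinearOrder β]

theorem finrank_reducedCocycles_add [Finite (G.ReducedEnhancedState r)] (i j : ℤ) :
    Module.finrank ℝ (G.reducedCocycles r i j) + Module.finrank ℝ (G.reducedCoboundaries r (i + 1) j)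
      = Module.finrank ℝ (G.reducedCochainGroup r i j) := by
  have h := LinearMap.finrank_range_add_finrank_ker
    ((G.reducedDifferential r).domRestrict (G.reducedCochainGroup r i j))
  rw [LinearMap.range_domRestrict, LinearMap.ker_domRestrict] at h
  rw [← h, reducedCoboundaries, add_sub_cancel_right, add_comm, reducedCocycles,
    ← Submodule.map_comap_subtype, Submodule.finrank_map_subtype_eq]

theorem reducedCoboundaries_le_reducedCocycles [Finite G.vertexSet] (hE : G.edgeSet.Finite)
    (i j : ℤ) : G.reducedCoboundaries r i j ≤ G.reducedCocycles r i j := by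
  rintro _ ⟨z, hz, rfl⟩
  refine ⟨?_, reducedDifferential_reducedDifferential hE z⟩
  simpa using reducedDifferential_mem hE hz

theorem finrank_reducedCohomology_add [Finite G.vertexSet] [Finite (G.ReducedEnhancedState r)]
    (hE : G.edgeSet.Finite) (i j : ℤ) :
    Module.finrank ℝ (G.ReducedCohomology r i j) + Module.finrank ℝ (G.reducedCoboundaries r i j)
      = Module.finrank ℝ (G.reducedCocycles r i j) := by
  rw [← (Submodule.submoduleOfEquivOfLe (reducedCoboundaries_le_reducedCocycles hE i j)).finrank_eq]
  exact Submodule.finrank_quotient_add_finrank _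

/-- Coboundaries in position `i` come from states with `i - 1` edges, and there are none unless `0 ≤
i - 1 ≤ |E|`. -/
theorem reducedCoboundaries_eq_bot (hE : G.edgeSet.Finite) {i : ℤ}
    (hi : i ≤ 0 ∨ G.edgeSet.ncard + 1 < i) (j : ℤ) : G.reducedCoboundaries r i j = ⊥ := by
  have : {s : G.ReducedEnhancedState r | s.dimension = i - 1 ∧ s.degree = j} = ∅ := by
    ext s
    have h1 := Set.ncard_le_ncard s.edges_subset hE
    simp only [ReducedEnhancedState.dimension, Set.mem_ofPred_eq, Set.mem_empty_iff_false, iff_false,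
      not_and]
    omega
  rw [reducedCoboundaries, reducedCochainGroup, this, Finsupp.supported_empty, Submodule.map_bot]

end EulerCharacteristic

end Graph

theorem mainTheorem7 {α α' β β' : Type*} [LinearOrder β] [LinearOrder β']
    (G : Graph α β) (G' : Graph α' β')
    (hV : G.vertexSet.Finite) (hE : G.edgeSet.Finite)
    (hV' : G'.vertexSet.Finite) (hE' : G'.edgeSet.Finite)
    (hG : G.IsConnected) (hG' : G'.IsConnected)
    (h : G.cycleMatroid.IsIsomorphic G'.cycleMatroid)
    (r : G.vertexSet) (r' : G'.vertexSet) (i j : ℤ) :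
    Nonempty (G.ReducedCohomology r i j ≃ₗ[ℝ] G'.ReducedCohomology r' i j) := by
  obtain ⟨φ, hφ⟩ := h
  change G.edgeSet ≃ G'.edgeSet at φ
  replace hφ : ∀ I : Set G.edgeSet,
      G.IsForest (Subtype.val '' I) ↔ G'.IsForest (Subtype.val '' (φ '' I)) := fun I => by
    rw [← Graph.cycleMatroid_indep_iff, ← Graph.cycleMatroid_indep_iff]
    exact hφ I
  have := hV.to_subtype
  have := hV'.to_subtype
  have := Graph.finite_reducedEnhancedState hV hE r
  have := Graph.finite_reducedEnhancedState hV' hE' r'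
  have hn := Graph.card_vertexSet_eq hV hE hV' hE' hG hG' φ hφ
  have hC := fun i => Graph.finrank_reducedCochainGroup_eq (r := r) (r' := r')
    hV hE hV' hE' hG hG' φ hφ i j
  have hZ := fun i => Graph.finrank_reducedCocycles_add (G := G) (r := r) i j
  have hZ' := fun i => Graph.finrank_reducedCocycles_add (G := G') (r := r') i j
  have hB : ∀ i, Module.finrank ℝ (G.reducedCoboundaries r i j) =
      Module.finrank ℝ (G'.reducedCoboundaries r' i j) := by
    -- For fixed `j`, the exceptional place `k` is where the row meets the diagonal `i + j = |V| -
    -- 1`; the bounds `m` and `N` are where the coboundaries of both graphs vanish.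
    refine eq_of_add_succ_eq (m := 0) (N := max G.edgeSet.ncard G'.edgeSet.ncard + 2)
      (k := Nat.card G.vertexSet - 1 - j) (fun i hi => ?_) (fun i hi => ?_) fun i hi => ?_
    · rw [Graph.reducedCoboundaries_eq_bot hE (Or.inl hi),
        Graph.reducedCoboundaries_eq_bot hE' (Or.inl hi), finrank_bot, finrank_bot]
    · rw [Graph.reducedCoboundaries_eq_bot hE (Or.inr (by omega)),
        Graph.reducedCoboundaries_eq_bot hE' (Or.inr (by omega)), finrank_bot, finrank_bot]
    · have hk : G.reducedCocycles r i j = G.reducedCoboundaries r i j :=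
        (Graph.reducedCocycles_le_reducedCoboundaries hE hG (by omega)).antisymm
          (Graph.reducedCoboundaries_le_reducedCocycles hE i j)
      have hk' : G'.reducedCocycles r' i j = G'.reducedCoboundaries r' i j :=
        (Graph.reducedCocycles_le_reducedCoboundaries hE' hG' (by omega)).antisymm
          (Graph.reducedCoboundaries_le_reducedCocycles hE' i j)
      rw [← hk, ← hk', hZ, hZ', hC]
  refine FiniteDimensional.nonempty_linearEquiv_of_finrank_eq ?_
  have h1 := Graph.finrank_reducedCohomology_add (r := r) hE i j
  have h2 := Graph.finrank_reducedCohomology_add (r := r') hE' i j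
  have h3 := hZ i
  have h4 := hZ' i
  have h5 := hC i
  have h6 := hB i
  have h7 := hB (i + 1)
  omega
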